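/- **Proposition 2.2.** Let $K$ be a perfect field with algebraic closure $\overline K$. Let $X\subset\mathbb P^4_K$ be a *9-nodal cubic threefold* over $K$, that is, a cubic hypersurface such that $X\otimes_K\overline K$ has exactly nine singular points and every $\mathrm{Gal}(\overline K/K)$-orbit of these points has at least four members. A *Perazzo cubic fourfold* over $K$ is a cubic hypersurface $Y\subset\mathbb P^5_K$ that is a Galois twist of $P=\{x_1x_2x_3=y_1y_2y_3\}$, that is, $Y\otimes_K\overline K$ is carried to $P\otimes_K\overline K$ by an invertible linear change of coordinates over $\overline K$. Then there are a Perazzo cubic fourfold $Y\subset\mathbb P^5_K$ over $K$ and a hyperplane $H\subset\mathbb P^5_K$ defined over $K$ such that $X$ is $K$-isomorphic to $Y\cap H$, through a $K$-linear isomorphism $\mathbb P^4_K\cong H$. -/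

import Mathlib

open scoped LinearAlgebra.Projectivization

noncomputable section

namespace NineNodal

/-- The algebraic closure of `K`. For a perfect field `K` it is a separable closure, and its group
of `K`-automorphisms is the absolute Galois group of `K`. -/
abbrev Kbar (K : Type*) [Field K] : Type _ := AlgebraicClosure K

/-- `F` is an equation of a cubic hypersurface in the projective space with homogeneous coordinates
indexed by `ι` (a cubic threefold for `ι = Fin 5`, a cubic fourfold for `ι = Fin 6`). -/
structure IsCubicForm {ι K : Type*} [Field K] (F : MvPolynomial ι K) : Prop where
  homogeneous : F.IsHomogeneous 3
  ne_zero : F ≠ 0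

/-- The pull-back of a form under the linear map with matrix `A`: the polynomial `F (A x)`, in
which the `i`-th variable of `F` is replaced by the linear form `∑ j, A i j * x j`. -/
def pullback {ι κ K : Type*} [Fintype κ] [Field K] (A : Matrix ι κ K) (F : MvPolynomial ι K) :
    MvPolynomial κ K :=
  MvPolynomial.bind₁ (fun i => ∑ j, MvPolynomial.C (A i j) * MvPolynomial.X j) F

/-- The base change to the algebraic closure of the hypersurface `F = 0`. -/
def geom {ι K : Type*} [Field K] (F : MvPolynomial ι K) : MvPolynomial ι (Kbar K) :=
  MvPolynomial.map (algebraMap K (Kbar K)) F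

/-- The singular points, over the algebraic closure, of the hypersurface `F = 0` (Jacobian
criterion). For a homogeneous `F` the conditions do not depend on the representative `p.rep` of
the point `p`. -/
def singularPoints {ι K : Type*} [Field K] (F : MvPolynomial ι K) :
    Set (ℙ (Kbar K) (ι → Kbar K)) :=
  {p | MvPolynomial.eval p.rep (geom F) = 0 ∧
    ∀ i, MvPolynomial.eval p.rep (MvPolynomial.pderiv i (geom F)) = 0}

/-- Coordinatewise application of `σ`, as a `σ`-semilinear map. -/
def conjVec {K : Type*} [Field K] (ι : Type*) (σ : Kbar K ≃ₐ[K] Kbar K) :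
    (ι → Kbar K) →ₛₗ[(σ : Kbar K →+* Kbar K)] (ι → Kbar K) where
  toFun v := fun i => σ (v i)
  map_add' v w := by ext i; simp
  map_smul' a v := by ext i; simp

theorem conjVec_injective {K : Type*} [Field K] (ι : Type*) (σ : Kbar K ≃ₐ[K] Kbar K) :
    Function.Injective (conjVec ι σ) := fun _ _ h =>
  funext fun i => σ.injective (congrFun h i)

/-- The action of the Galois group on geometric points of projective space:
`[v₀ : v₁ : …] ↦ [σ v₀ : σ v₁ : …]`. -/
def conjPoint {K ι : Type*} [Field K] (σ : Kbar K ≃ₐ[K] Kbar K) (p : ℙ (Kbar K) (ι → Kbar K)) :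
    ℙ (Kbar K) (ι → Kbar K) :=
  Projectivization.map (conjVec ι σ) (conjVec_injective ι σ) p

/-- The set of Galois conjugates of a geometric point. -/
def galoisOrbit {K ι : Type*} [Field K] (p : ℙ (Kbar K) (ι → Kbar K)) :
    Set (ℙ (Kbar K) (ι → Kbar K)) :=
  Set.range fun σ : Kbar K ≃ₐ[K] Kbar K => conjPoint σ p

/-- The cubic form `f` over `K` defines a 9-nodal cubic threefold: over the algebraic closure there
are exactly nine singular points, and each of their Galois orbits has at least four members. -/
structure IsNineNodalCubicThreefold {K : Type*} [Field K] (f : MvPolynomial (Fin 5) K) :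
    Prop where
  cubic : IsCubicForm f
  nine : (singularPoints f).encard = 9
  orbits : ∀ p ∈ singularPoints f, 4 ≤ (galoisOrbit p).encard

/-- The equation `x₁x₂x₃ - y₁y₂y₃` of the split Perazzo cubic, the coordinates being
`(x₁, x₂, x₃, y₁, y₂, y₃)`. -/
def perazzoForm (L : Type*) [Field L] : MvPolynomial (Fin 6) L :=
  MvPolynomial.X 0 * MvPolynomial.X 1 * MvPolynomial.X 2 -
    MvPolynomial.X 3 * MvPolynomial.X 4 * MvPolynomial.X 5

/-- The cubic fourfold `F = 0` over `K` is a Galois twist of the Perazzo cubic: over the algebraic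
closure, an invertible linear change of coordinates carries the one to the other. -/
structure IsPerazzoCubicFourfold {K : Type*} [Field K] (F : MvPolynomial (Fin 6) K) : Prop where
  cubic : IsCubicForm F
  twist : ∃ (g : GL (Fin 6) (Kbar K)) (c : (Kbar K)ˣ),
    pullback (g : Matrix (Fin 6) (Fin 6) (Kbar K)) (geom F) =
      MvPolynomial.C (c : Kbar K) * perazzoForm (Kbar K)

/-- The threefold `f = 0` is `K`-isomorphic to the section of the fourfold `F = 0` by some
hyperplane `∑ i, ℓ i * z i = 0` over `K`: an injective linear map with matrix `A` identifies the
projective space of `f` with that hyperplane, and `F` restricts to a nonzero multiple of `f`. -/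
def IsHyperplaneSection {K : Type*} [Field K] (f : MvPolynomial (Fin 5) K)
    (F : MvPolynomial (Fin 6) K) : Prop :=
  ∃ ℓ : Fin 6 → K, ℓ ≠ 0 ∧
    ∃ A : Matrix (Fin 6) (Fin 5) K, Function.Injective A.mulVec ∧
      Set.range A.mulVec = {z | ∑ i, ℓ i * z i = 0} ∧
      ∃ c : Kˣ, pullback A F = MvPolynomial.C (c : K) * f

end NineNodal

end

/-! Over the algebraic closure, write the cubic in a frame of five singular points. No coordinate
then occurs with exponent two or more, so the cubic is a combination of the ten products of three
distinct coordinates. Since the singularities are isolated, the support of a singular point has one,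
three or five elements (`IsolatedSing.card_support`), and the support determines the point. The same
count shows that four vectors could not account for nine points, so a frame exists
(`exists_singular_basis`).

A point with support of size three is recorded by the pair of its vanishing coordinates, an edge of
a graph on five vertices. Each edge kills one coefficient of the cubic and makes certain 2 by 2
minors of the others nonzero. Nine points give four edges, or three edges and a point in general
position. Stars and triangles contradict the minors; in the remaining cases the cubic is visibly a
sum of two products of three linear forms with one linear relation (`of_cycle`, `of_path`,
`of_path_unit`).

The six forms descend to the ground field as follows. The nodes are the nine points where two forms
of each product vanish, and the six hyperplanes are exactly those that contain at least six nodes,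
so the Galois group permutes them. Scaling each form to leading coefficient 1 gives vectors `N i`
that are permuted themselves (`exists_galois_forms`). Some six monomials, evaluated at the `N i`,
form an invertible matrix `M` (`exists_monomial_matrix`) whose rows are permuted in the same way, so
`M⁻¹ * N` is Galois invariant and embeds the given space into a 6-space over the ground field. The
sum of two products, in the coordinates given by `M`, is invariant as well, because its restriction
to the hyperplane determines the two blocks and their coefficients (`block_unique`). -/

noncomputable section

namespace NineNodal

/-! ### Cubics given by trilinear forms, and their singular vectors, in any characteristic. -/

section Trilinear

variable {k V : Type*} [Field k] [AddCommGroup V] [Module k V] (c : V →ₗ[k] V →ₗ[k] V →ₗ[k] k)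

/-- The cubic function attached to a trilinear form. -/
def cub (v : V) : k := c v v v

/-- The derivative of `cub c` at `v` in the direction `w`. -/
def dcub (v w : V) : k := c w v v + c v w v + c v v w

/-- The full polarization of `cub c`. -/
def pol (u v w : V) : k := c u v w + c u w v + c v u w + c v w u + c w u v + c w v u

/-- `v` is a singular vector of the cubic `cub c`. -/
structure IsSing (v : V) : Prop where
  cub_eq : cub c v = 0
  dcub_eq : ∀ w, dcub c v w = 0

/-- The cubic `cub c` has no one-parameter families of pairwise independent singular vectors. -/
def IsolatedSing : Prop :=
  ∀ Z : Set k, Z.Finite → ∀ φ : k → V, (∀ s ∉ Z, IsSing c (φ s)) →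
    (∀ s ∉ Z, ∀ s' ∉ Z, s ≠ s' → ∀ a b : k, a • φ s + b • φ s' = 0 → a = 0 ∧ b = 0) → False

variable {c}

theorem cub_add (u v : V) : cub c (u + v) = cub c u + dcub c u v + dcub c v u + cub c v := by
  simp only [cub, dcub, map_add, LinearMap.add_apply]; ring

theorem cub_smul (a : k) (u : V) : cub c (a • u) = a ^ 3 * cub c u := by
  simp only [cub, map_smul, LinearMap.smul_apply, smul_eq_mul]; ring

theorem dcub_add (u v w : V) : dcub c (u + v) w = dcub c u w + dcub c v w + pol c u v w := by
  simp only [pol, dcub, map_add, LinearMap.add_apply]; ring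

theorem dcub_smul (a : k) (u w : V) : dcub c (a • u) w = a ^ 2 * dcub c u w := by
  simp only [dcub, map_smul, LinearMap.smul_apply, smul_eq_mul]; ring

theorem dcub_add_right (u v w : V) : dcub c u (v + w) = dcub c u v + dcub c u w := by
  simp only [dcub, map_add, LinearMap.add_apply]; ring

theorem dcub_smul_right (a : k) (u v : V) : dcub c u (a • v) = a * dcub c u v := by
  simp only [dcub, map_smul, LinearMap.smul_apply, smul_eq_mul]; ring

theorem pol_swap₁₂ (u v w : V) : pol c u v w = pol c v u w := by
  simp only [pol]; ring

theorem pol_swap₂₃ (u v w : V) : pol c u v w = pol c u w v := by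
  simp only [pol]; ring

theorem pol_add_left (u v w z : V) : pol c (u + v) w z = pol c u w z + pol c v w z := by
  simp only [pol, map_add, LinearMap.add_apply]; ring

theorem pol_smul_left (a : k) (u v w : V) : pol c (a • u) v w = a * pol c u v w := by
  simp only [pol, map_smul, LinearMap.smul_apply, smul_eq_mul]; ring

theorem pol_smul_mid (a : k) (u v w : V) : pol c u (a • v) w = a * pol c u v w := by
  simp only [pol, map_smul, LinearMap.smul_apply, smul_eq_mul]; ring

theorem pol_smul_right (a : k) (u v w : V) : pol c u v (a • w) = a * pol c u v w := by
  simp only [pol, map_smul, LinearMap.smul_apply, smul_eq_mul]; ring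

theorem pol_add_right (u v w z : V) : pol c u v (w + z) = pol c u v w + pol c u v z := by
  simp only [pol, map_add, LinearMap.add_apply]; ring

theorem pol_self (u w : V) : pol c u u w = 2 * dcub c u w := by
  simp only [pol, dcub]; ring

theorem IsSing.pol_self_left {u : V} (hu : IsSing c u) (w : V) : pol c u u w = 0 := by
  rw [pol_self, hu.dcub_eq, mul_zero]

theorem IsSing.pol_self_right {u : V} (hu : IsSing c u) (w : V) : pol c w u u = 0 := by
  rw [pol_swap₁₂, pol_swap₂₃, hu.pol_self_left]

theorem IsSing.pol_self_outer {u : V} (hu : IsSing c u) (w : V) : pol c u w u = 0 := by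
  rw [pol_swap₂₃, hu.pol_self_left]

theorem IsSing.smul {v : V} (hv : IsSing c v) (a : k) : IsSing c (a • v) :=
  ⟨by rw [cub_smul, hv.cub_eq, mul_zero], fun w => by rw [dcub_smul, hv.dcub_eq, mul_zero]⟩

/-- The square terms carry the derivative at a singular vector, so only the mixed term survives.
This expansion and the longer ones below show that a cubic is squarefree in coordinates with respect
to singular vectors. -/
theorem dcub_two {p q : V} (hp : IsSing c p) (hq : IsSing c q) (x y : k) (w : V) :
    dcub c (x • p + y • q) w = x * y * pol c p q w := by
  simp only [dcub_add, dcub_smul, hp.dcub_eq, hq.dcub_eq, pol_smul_left, pol_smul_mid]; ring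

theorem cub_two {p q : V} (hp : IsSing c p) (hq : IsSing c q) (x y : k) :
    cub c (x • p + y • q) = 0 := by
  simp only [cub_add, cub_smul, dcub_smul, hp.dcub_eq, hq.dcub_eq, hp.cub_eq, hq.cub_eq]; ring

theorem dcub_three {p q r : V} (hp : IsSing c p) (hq : IsSing c q) (hr : IsSing c r)
    (x y z : k) (w : V) :
    dcub c (x • p + y • q + z • r) w =
      x * y * pol c p q w + x * z * pol c p r w + y * z * pol c q r w := by
  rw [dcub_add, dcub_two hp hq]
  simp only [dcub_smul, hr.dcub_eq, pol_smul_left, pol_smul_mid, pol_add_left]; ring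

theorem cub_three {p q r : V} (hp : IsSing c p) (hq : IsSing c q) (hr : IsSing c r) (x y z : k) :
    cub c (x • p + y • q + z • r) = x * y * z * pol c p q r := by
  rw [cub_add, cub_two hp hq, dcub_two hp hq]
  simp only [cub_smul, dcub_smul, hr.dcub_eq, hr.cub_eq, pol_smul_right]; ring

theorem dcub_four {p q r s : V} (hp : IsSing c p) (hq : IsSing c q) (hr : IsSing c r)
    (hs : IsSing c s) (x y z u : k) (w : V) :
    dcub c (x • p + y • q + z • r + u • s) w =
      x * y * pol c p q w + x * z * pol c p r w + y * z * pol c q r w + x * u * pol c p s w +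
        y * u * pol c q s w + z * u * pol c r s w := by
  rw [dcub_add, dcub_three hp hq hr]
  simp only [dcub_smul, hs.dcub_eq, pol_smul_left, pol_smul_mid, pol_add_left]; ring

theorem cub_four {p q r s : V} (hp : IsSing c p) (hq : IsSing c q) (hr : IsSing c r)
    (hs : IsSing c s) (x y z u : k) :
    cub c (x • p + y • q + z • r + u • s) =
      x * y * z * pol c p q r + x * y * u * pol c p q s + x * z * u * pol c p r s +
        y * z * u * pol c q r s := by
  rw [cub_add, cub_three hp hq hr, dcub_three hp hq hr]
  simp only [cub_smul, dcub_smul, hs.dcub_eq, hs.cub_eq, pol_smul_right]; ring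

theorem dcub_five {p q r s t : V} (hp : IsSing c p) (hq : IsSing c q) (hr : IsSing c r)
    (hs : IsSing c s) (ht : IsSing c t) (x y z u v : k) (w : V) :
    dcub c (x • p + y • q + z • r + u • s + v • t) w =
      x * y * pol c p q w + x * z * pol c p r w + y * z * pol c q r w + x * u * pol c p s w +
        y * u * pol c q s w + z * u * pol c r s w + x * v * pol c p t w + y * v * pol c q t w +
        z * v * pol c r t w + u * v * pol c s t w := by
  rw [dcub_add, dcub_four hp hq hr hs]
  simp only [dcub_smul, ht.dcub_eq, pol_smul_left, pol_smul_mid, pol_add_left]; ring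

theorem cub_five {p q r s t : V} (hp : IsSing c p) (hq : IsSing c q) (hr : IsSing c r)
    (hs : IsSing c s) (ht : IsSing c t) (x y z u v : k) :
    cub c (x • p + y • q + z • r + u • s + v • t) =
      x * y * z * pol c p q r + x * y * u * pol c p q s + x * z * u * pol c p r s +
        y * z * u * pol c q r s + x * y * v * pol c p q t + x * z * v * pol c p r t +
        y * z * v * pol c q r t + x * u * v * pol c p s t + y * u * v * pol c q s t +
        z * u * v * pol c r s t := by
  rw [cub_add, cub_four hp hq hr hs, dcub_four hp hq hr hs]
  simp only [cub_smul, dcub_smul, ht.dcub_eq, ht.cub_eq, pol_smul_right]; ring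

/-- Singular vectors whose coordinates are the inverses of those on a line come in a family. -/
theorem IsolatedSing.not_inv_line (hc : IsolatedSing c) {ι : Type*} [Fintype ι] {e : ι → V}
    (he : LinearIndependent k e) {t t' : ι → k} (ht : ∀ i, t i ≠ 0)
    (hind : ∀ a b : k, (∀ i, a * t i + b * t' i = 0) → a = 0 ∧ b = 0)
    (hs : ∀ s : k, (∀ i, t i + s * t' i ≠ 0) → IsSing c (∑ i, (t i + s * t' i)⁻¹ • e i)) :
    False := by
  refine hc {s | ∃ i, t i + s * t' i = 0} ?_ (fun s => ∑ i, (t i + s * t' i)⁻¹ • e i) ?_ ?_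
  · refine (Set.finite_range fun i => -t i / t' i).subset ?_
    rintro s ⟨i, hi⟩
    refine ⟨i, ?_⟩
    have h' : t' i ≠ 0 := by
      intro h0; rw [h0, mul_zero, add_zero] at hi; exact ht i hi
    simp only
    rw [div_eq_iff h']; linear_combination -hi
  · intro s hs'
    exact hs s (by simpa using hs')
  · intro s hs1 s' hs2 hne a b hab
    simp only [Set.mem_ofPred_eq, not_exists] at hs1 hs2
    rw [Finset.smul_sum, Finset.smul_sum, ← Finset.sum_add_distrib] at hab
    have h1 := Fintype.linearIndependent_iff.1 he
      (fun i => a * (t i + s * t' i)⁻¹ + b * (t i + s' * t' i)⁻¹)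
      (by simpa only [add_smul, mul_smul] using hab)
    -- Clearing denominators in a dependence between the members at `s` and `s'` gives a dependence
    -- between `t` and `t'` with these coefficients.
    obtain ⟨h2, h3⟩ := hind (a + b) (a * s' + b * s) (by
      intro i
      have h4 := mul_inv_cancel₀ (hs1 i)
      have h5 := mul_inv_cancel₀ (hs2 i)
      linear_combination (t i + s * t' i) * (t i + s' * t' i) * h1 i -
        a * (t i + s' * t' i) * h4 - b * (t i + s * t' i) * h5)
    have hb : b = -a := by linear_combination h2
    subst hb
    have : a * (s' - s) = 0 := by linear_combination h3
    rcases mul_eq_zero.1 this with h | h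
    · simp [h]
    · exact absurd (sub_eq_zero.1 h).symm hne

/-- Otherwise every point of the line through `p` and `q` would be singular. -/
theorem IsolatedSing.exists_pol_two (hc : IsolatedSing c) {p q : V}
    (hp : IsSing c p) (hq : IsSing c q) (he : LinearIndependent k ![p, q]) :
    ∃ w, pol c p q w ≠ 0 := by
  by_contra! h
  refine hc ∅ Set.finite_empty (fun s => (1 : k) • p + s • q) ?_ ?_
  · intro s _
    exact ⟨cub_two hp hq _ _, fun w => by rw [dcub_two hp hq, h, mul_zero]⟩
  · intro s _ s' _ hne a b hab
    obtain ⟨h1, h2⟩ := LinearIndependent.pair_iff.1 he (a + b) (a * s + b * s') (by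
      rw [← hab]; module)
    have hb : b = -a := by linear_combination h1
    subst hb
    have : a * (s - s') = 0 := by linear_combination h2
    rcases mul_eq_zero.1 this with h | h
    · simp [h]
    · exact absurd (sub_eq_zero.1 h) hne

/-- No third singular point on the line through two singular points. -/
theorem IsolatedSing.not_two (hc : IsolatedSing c) {p q : V}
    (hp : IsSing c p) (hq : IsSing c q) (he : LinearIndependent k ![p, q]) {x y : k}
    (hx : x ≠ 0) (hy : y ≠ 0) : ¬ IsSing c (x • p + y • q) := by
  intro h
  obtain ⟨w, hw⟩ := hc.exists_pol_two hp hq he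
  have := h.dcub_eq w
  rw [dcub_two hp hq] at this
  simp_all

/-- No singular point in general position on the solid spanned by four singular points. -/
theorem IsolatedSing.not_four (hc : IsolatedSing c) {e : Fin 4 → V} (hs : ∀ i, IsSing c (e i))
    (he : LinearIndependent k e) {w₀ : V}
    (hspan : ∀ v : V, ∃ (x : Fin 4 → k) (a : k), v = ∑ i, x i • e i + a • w₀)
    {x : Fin 4 → k} (hx : ∀ i, x i ≠ 0) : ¬ IsSing c (∑ i, x i • e i) := by
  intro hv
  rw [Fin.sum_univ_four] at hv
  have hd := fun i => hv.dcub_eq (e i)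
  have hf := hv.cub_eq
  have d0 := hd 0
  have d1 := hd 1
  have d2 := hd 2
  have d3 := hd 3
  rw [cub_four (hs 0) (hs 1) (hs 2) (hs 3)] at hf
  rw [dcub_four (hs 0) (hs 1) (hs 2) (hs 3)] at d0 d1 d2 d3
  simp only [(hs _).pol_self_right, (hs _).pol_self_outer] at d0 d1 d2 d3
  rw [pol_swap₂₃, pol_swap₁₂ (e 1) (e 0), pol_swap₂₃ (e 1), pol_swap₁₂ (e 1) (e 0),
    pol_swap₂₃ (e 2), pol_swap₁₂ (e 2) (e 0)] at d0
  rw [pol_swap₂₃ (e 0) (e 2), pol_swap₂₃ (e 0) (e 3), pol_swap₂₃ (e 2), pol_swap₁₂ (e 2)] at d1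
  rw [pol_swap₂₃ (e 0) (e 3), pol_swap₂₃ (e 1) (e 3)] at d2
  have h0 := hx 0
  have h1 := hx 1
  have h2 := hx 2
  have h3 := hx 3
  -- The product `x 0 * d0` collects the terms of the cubic that contain `x 0`; subtracting it
  -- leaves the one term without `x 0`.
  have z123 : pol c (e 1) (e 2) (e 3) = 0 := by
    have : x 1 * x 2 * x 3 * pol c (e 1) (e 2) (e 3) = 0 := by linear_combination hf - x 0 * d0
    simpa [h1, h2, h3] using this
  have z023 : pol c (e 0) (e 2) (e 3) = 0 := by
    have : x 0 * x 2 * x 3 * pol c (e 0) (e 2) (e 3) = 0 := by linear_combination hf - x 1 * d1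
    simpa [h0, h2, h3] using this
  have z013 : pol c (e 0) (e 1) (e 3) = 0 := by
    have : x 0 * x 1 * x 3 * pol c (e 0) (e 1) (e 3) = 0 := by linear_combination hf - x 2 * d2
    simpa [h1, h0, h3] using this
  have z012 : pol c (e 0) (e 1) (e 2) = 0 := by
    have : x 0 * x 1 * x 2 * pol c (e 0) (e 1) (e 2) = 0 := by linear_combination hf - x 3 * d3
    simpa [h1, h2, h0] using this
  have hpair : ∀ i j : Fin 4, i ≠ j → LinearIndependent k ![e i, e j] := by
    intro i j hij
    have := he.comp ![i, j] (by
      intro a b; fin_cases a <;> fin_cases b <;> simp [hij, hij.symm])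
    convert this using 1
    ext a; fin_cases a <;> rfl
  -- All triple polarizations of the `e i` vanish, so each linear form `pol c (e i) (e j)` is known
  -- from its value at `w₀`.
  have hw : ∀ (i j : Fin 4), (∀ l, pol c (e i) (e j) (e l) = 0) → ∀ w, ∃ a : k,
      pol c (e i) (e j) w = a * pol c (e i) (e j) w₀ := by
    intro i j hij w
    obtain ⟨y, a, rfl⟩ := hspan w
    refine ⟨a, ?_⟩
    simp [Fin.sum_univ_four, pol_add_right, pol_smul_right, hij]
  have t01 : ∀ l, pol c (e 0) (e 1) (e l) = 0 := by
    intro l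
    fin_cases l
    · exact (hs 0).pol_self_outer _
    · exact (hs 1).pol_self_right _
    · exact z012
    · exact z013
  have t02 : ∀ l, pol c (e 0) (e 2) (e l) = 0 := by
    intro l
    fin_cases l
    · exact (hs 0).pol_self_outer _
    · exact (pol_swap₂₃ _ _ _).trans z012
    · exact (hs 2).pol_self_right _
    · exact z023
  have t12 : ∀ l, pol c (e 1) (e 2) (e l) = 0 := by
    intro l
    fin_cases l
    · exact ((pol_swap₂₃ _ _ _).trans (pol_swap₁₂ _ _ _)).trans z012
    · exact (hs 1).pol_self_outer _
    · exact (hs 2).pol_self_right _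
    · exact z123
  have nz : pol c (e 0) (e 2) w₀ ≠ 0 := by
    intro h
    obtain ⟨w, hw'⟩ := hc.exists_pol_two (hs 0) (hs 2) (hpair 0 2 (by decide))
    obtain ⟨a, ha⟩ := hw 0 2 t02 w
    rw [ha, h, mul_zero] at hw'
    exact hw' rfl
  set P := pol c (e 0) (e 1) w₀ with hP
  set Q := pol c (e 0) (e 2) w₀ with hQ
  set R := pol c (e 1) (e 2) w₀ with hR
  -- At `e 0 + s • e 1 + z • e 2` the only remaining condition is `s * P + z * Q + s * z * R = 0`.
  -- Solving it for `z` gives a curve of singular points; `Q ≠ 0` keeps the set of excluded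
  -- parameters finite.
  refine hc {s | Q + s * R = 0} ?_
    (fun s => (1 : k) • e 0 + s • e 1 + (-(s * P) / (Q + s * R)) • e 2) ?_ ?_
  · refine (Set.finite_singleton (-Q / R)).subset ?_
    intro s (hs : Q + s * R = 0)
    have : R ≠ 0 := by rintro h; rw [h] at hs; simp at hs; exact nz hs
    rw [Set.mem_singleton_iff, eq_div_iff this]
    linear_combination hs
  · intro s hs'
    have hs' : Q + s * R ≠ 0 := hs'
    refine ⟨by rw [cub_three (hs 0) (hs 1) (hs 2), z012, mul_zero], fun w => ?_⟩
    rw [dcub_three (hs 0) (hs 1) (hs 2)]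
    obtain ⟨y, a, rfl⟩ := hspan w
    simp only [Fin.sum_univ_four, pol_add_right, pol_smul_right, t01, t02, t12, ← hP, ← hQ, ← hR]
    field_simp
    ring
  · intro s _ s' _ hne a b hab
    have := Fintype.linearIndependent_iff.1 he
      ![a + b, a * s + b * s', a * (-(s * P) / (Q + s * R)) + b * (-(s' * P) / (Q + s' * R)), 0] (by
      rw [Fin.sum_univ_four, ← hab]
      simp only [Matrix.cons_val]
      module)
    have h1 := this 0
    have h2 := this 1
    simp only [Matrix.cons_val] at h1 h2
    have hb : b = -a := by linear_combination h1
    subst hb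
    have : a * (s - s') = 0 := by linear_combination h2
    rcases mul_eq_zero.1 this with h | h
    · simp [h]
    · exact absurd (sub_eq_zero.1 h) hne

/-- The singular points in general position on the plane of three singular points `p, q, r`
correspond to the solutions of a linear system, so there is at most one. -/
theorem IsolatedSing.three_unique (hc : IsolatedSing c) {p q r : V}
    (hp : IsSing c p) (hq : IsSing c q) (hr : IsSing c r) (he : LinearIndependent k ![p, q, r])
    {t t' : Fin 3 → k} (ht : ∀ i, t i ≠ 0) (h0 : pol c p q r = 0)
    (h : ∀ w, t 2 * pol c p q w + t 1 * pol c p r w + t 0 * pol c q r w = 0)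
    (h' : ∀ w, t' 2 * pol c p q w + t' 1 * pol c p r w + t' 0 * pol c q r w = 0) :
    ∃ a : k, ∀ i, t' i = a * t i := by
  by_contra! hn
  refine hc.not_inv_line he (t := t) (t' := t') ht ?_ ?_
  · intro a b hab
    by_cases hb : b = 0
    · subst hb
      have := hab 0
      simp [ht 0] at this
      simp [this]
    · obtain ⟨i, hi⟩ := hn (-a / b)
      refine absurd ?_ hi
      field_simp
      linear_combination hab i
  · intro s hs
    rw [Fin.sum_univ_three]
    refine ⟨by
      simp only [Matrix.cons_val]
      rw [cub_three hp hq hr, h0, mul_zero], fun w => ?_⟩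
    simp only [Matrix.cons_val]
    rw [dcub_three hp hq hr]
    have := hs 0
    have := hs 1
    have := hs 2
    field_simp
    linear_combination h w + s * h' w

/-- A singular point in general position on the plane of three singular points `p, q, r`. -/
theorem IsSing.three {p q r : V}
    (hp : IsSing c p) (hq : IsSing c q) (hr : IsSing c r) {x y z : k} (hx : x ≠ 0) (hy : y ≠ 0)
    (hz : z ≠ 0) (h : IsSing c (x • p + y • q + z • r)) :
    pol c p q r = 0 ∧
      ∀ w, z⁻¹ * pol c p q w + y⁻¹ * pol c p r w + x⁻¹ * pol c q r w = 0 := by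
  constructor
  · have := h.cub_eq
    rw [cub_three hp hq hr] at this
    simpa [hx, hy, hz] using this
  · intro w
    have := h.dcub_eq w
    rw [dcub_three hp hq hr] at this
    field_simp
    linear_combination this

end Trilinear

/-! ### Singular points in general position on the faces of a frame of singular points. -/

section Frames

variable {k V : Type*} [Field k] [AddCommGroup V] [Module k V] {c : V →ₗ[k] V →ₗ[k] V →ₗ[k] k}

/-- The two linear equations that determine a singular point on the plane of three singular
points are independent, and none of the coordinates of their solution vanishes. -/
theorem IsolatedSing.minors_ne_zero (hc : IsolatedSing c) {p q r u u' : V}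
    (hp : IsSing c p) (hq : IsSing c q) (hr : IsSing c r) (he : LinearIndependent k ![p, q, r])
    (hspan : ∀ v : V, ∃ a b d m n : k, v = a • p + b • q + d • r + m • u + n • u')
    {x y z : k} (hx : x ≠ 0) (hy : y ≠ 0) (hz : z ≠ 0) (h : IsSing c (x • p + y • q + z • r)) :
    pol c p q r = 0 ∧
      pol c q r u * pol c p r u' - pol c p r u * pol c q r u' ≠ 0 ∧
      pol c q r u * pol c p q u' - pol c p q u * pol c q r u' ≠ 0 ∧
      pol c p r u * pol c p q u' - pol c p q u * pol c p r u' ≠ 0 := by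
  obtain ⟨h0, ht⟩ := hp.three hq hr hx hy hz h
  refine ⟨h0, ?_⟩
  -- The equations at `p`, `q`, `r` hold automatically, so those at `u` and `u'` are the whole
  -- system.
  have hall : ∀ t' : Fin 3 → k,
      (t' 2 * pol c p q u + t' 1 * pol c p r u + t' 0 * pol c q r u = 0) →
      (t' 2 * pol c p q u' + t' 1 * pol c p r u' + t' 0 * pol c q r u' = 0) →
      ∃ a : k, ∀ i, t' i = a * ![x⁻¹, y⁻¹, z⁻¹] i := by
    intro t' hu hu'
    refine hc.three_unique hp hq hr he ?_ h0 ht ?_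
    · intro i; fin_cases i <;> simpa
    · intro w
      obtain ⟨a, b, d, m, n, rfl⟩ := hspan w
      have h1 : pol c p r q = 0 := by rw [pol_swap₂₃, h0]
      have h2 : pol c q r p = 0 := by rw [pol_swap₂₃, pol_swap₁₂, h0]
      simp only [pol_add_right, pol_smul_right, hp.pol_self_outer, hq.pol_self_right,
        hq.pol_self_outer, hr.pol_self_right, h0, h1, h2]
      linear_combination m * hu + n * hu'
  have hu := ht u
  have hu' := ht u'
  have X : x⁻¹ ≠ 0 := inv_ne_zero hx
  have Y : y⁻¹ ≠ 0 := inv_ne_zero hy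
  have Z : z⁻¹ ≠ 0 := inv_ne_zero hz
  generalize x⁻¹ = X' at *
  generalize y⁻¹ = Y' at *
  generalize z⁻¹ = Z' at *
  generalize pol c p q u = r2 at *
  generalize pol c p r u = r1 at *
  generalize pol c q r u = r0 at *
  generalize pol c p q u' = s2 at *
  generalize pol c p r u' = s1 at *
  generalize pol c q r u' = s0 at *
  have key : r0 * s1 - r1 * s0 = 0 → False := by
    intro hm
    -- A solution with third coordinate zero is a multiple of the known one, whose third coordinate
    -- is nonzero, so it vanishes. A zero minor would produce a nonzero solution of this kind.
    have hz1 : ∀ α β : k, (α * r0 + β * r1 = 0) → (α * s0 + β * s1 = 0) → α = 0 ∧ β = 0 := by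
      intro α β h1 h2
      obtain ⟨a, ha⟩ := hall ![α, β, 0] (by simp; linear_combination h1)
        (by simp; linear_combination h2)
      have a0 := ha 0
      have a1 := ha 1
      have a2 := ha 2
      simp only [Matrix.cons_val] at a0 a1 a2
      have ha0 : a = 0 := by simpa [Z] using a2.symm
      exact ⟨by rw [a0, ha0, zero_mul], by rw [a1, ha0, zero_mul]⟩
    obtain ⟨e1, e2⟩ := hz1 r1 (-r0) (by ring) (by linear_combination -hm)
    have e2 : r0 = 0 := by simpa using e2
    obtain ⟨e3, e4⟩ := hz1 s1 (-s0) (by linear_combination hm) (by ring)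
    have e4 : s0 = 0 := by simpa using e4
    have := hz1 1 0 (by simp [e2]) (by simp [e4])
    simp at this
  -- The three minors are, up to sign, proportional to the nonzero coordinates of the solution, so
  -- they vanish together.
  refine ⟨fun hm => key hm, fun hm => key ?_, fun hm => key ?_⟩
  · have : Y' * (r0 * s1 - r1 * s0) = 0 := by linear_combination r0 * hu' - s0 * hu - Z' * hm
    simpa [Y] using this
  · have : X' * (r0 * s1 - r1 * s0) = 0 := by
      linear_combination s1 * hu - r1 * hu' + Z' * hm
    simpa [X] using this

theorem exists_complement [Module.Finite k V] {n : ℕ} (hV : Module.finrank k V = n + 1)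
    {e : Fin n → V} (he : LinearIndependent k e) :
    ∃ w₀ : V, ∀ v : V, ∃ (x : Fin n → k) (a : k), v = ∑ i, x i • e i + a • w₀ := by
  have hlt : Submodule.span k (Set.range e) ≠ ⊤ := by
    intro h
    have := finrank_span_eq_card he
    rw [h, finrank_top, hV, Fintype.card_fin] at this
    omega
  obtain ⟨w₀, hw⟩ := SetLike.exists_not_mem_of_ne_top _ hlt rfl
  have hli : LinearIndependent k (Fin.cons w₀ e : Fin (n + 1) → V) :=
    linearIndependent_finCons.2 ⟨he, hw⟩
  let b := basisOfLinearIndependentOfCardEqFinrank hli (by simp [hV])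
  refine ⟨w₀, fun v => ⟨fun i => b.repr v i.succ, b.repr v 0, ?_⟩⟩
  conv_lhs => rw [← b.sum_repr v]
  rw [Fin.sum_univ_succ, add_comm]
  simp [b]

theorem exists_enum {ι : Type*} (V : Type*) [AddCommMonoid V] {S : Finset ι} {n : ℕ}
    (h : S.card = n) :
    ∃ E : Fin n → ι, Function.Injective E ∧ (∀ a, E a ∈ S) ∧ (∀ i ∈ S, ∃ a, E a = i) ∧
      ∀ g : ι → V, ∑ i ∈ S, g i = ∑ a, g (E a) := by
  let E := S.equivFinOfCardEq h
  refine ⟨fun a => (E.symm a).1, ?_, fun a => (E.symm a).2, fun i hi => ⟨E ⟨i, hi⟩, by simp⟩, ?_⟩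
  · exact Subtype.val_injective.comp E.symm.injective
  · intro g
    rw [← Finset.sum_coe_sort, ← E.symm.sum_comp]

section Supports

variable {ι : Type*} {e : ι → V}

theorem IsolatedSing.card_ne_two (hc : IsolatedSing c) (hs : ∀ i, IsSing c (e i))
    (he : LinearIndependent k e) {S : Finset ι} {x : ι → k} (hx : ∀ i ∈ S, x i ≠ 0)
    (hv : IsSing c (∑ i ∈ S, x i • e i)) : S.card ≠ 2 := by
  intro h
  obtain ⟨E, hE, hES, -, hsum⟩ := exists_enum V h
  rw [hsum, Fin.sum_univ_two] at hv
  refine hc.not_two (hs (E 0)) (hs (E 1)) ?_ (hx _ (hES _)) (hx _ (hES _)) hv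
  convert he.comp E hE using 1
  ext a; fin_cases a <;> rfl

theorem IsolatedSing.card_ne_four [Module.Finite k V] (hV : Module.finrank k V = 5)
    (hc : IsolatedSing c) (hs : ∀ i, IsSing c (e i))
    (he : LinearIndependent k e) {S : Finset ι} {x : ι → k} (hx : ∀ i ∈ S, x i ≠ 0)
    (hv : IsSing c (∑ i ∈ S, x i • e i)) : S.card ≠ 4 := by
  intro h
  obtain ⟨E, hE, hES, -, hsum⟩ := exists_enum V h
  rw [hsum] at hv
  obtain ⟨w₀, hw⟩ := exists_complement hV (he.comp E hE)
  exact hc.not_four (e := e ∘ E) (fun i => hs _) (he.comp E hE) hw (x := x ∘ E)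
    (fun i => hx _ (hES _)) hv

theorem IsolatedSing.three_proportional (hc : IsolatedSing c) (hs : ∀ i, IsSing c (e i))
    (he : LinearIndependent k e) {S : Finset ι} (hS : S.card = 3) {x x' : ι → k}
    (hx : ∀ i ∈ S, x i ≠ 0) (hx' : ∀ i ∈ S, x' i ≠ 0)
    (hv : IsSing c (∑ i ∈ S, x i • e i)) (hv' : IsSing c (∑ i ∈ S, x' i • e i)) :
    ∃ a : k, ∑ i ∈ S, x' i • e i = a • ∑ i ∈ S, x i • e i := by
  obtain ⟨E, hE, hES, -, hsum⟩ := exists_enum V hS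
  rw [hsum, Fin.sum_univ_three] at hv hv'
  obtain ⟨h0, h⟩ := (hs _).three (hs _) (hs _) (hx _ (hES _)) (hx _ (hES _)) (hx _ (hES _)) hv
  obtain ⟨-, h'⟩ := (hs _).three (hs _) (hs _) (hx' _ (hES _)) (hx' _ (hES _)) (hx' _ (hES _)) hv'
  obtain ⟨a, ha⟩ := hc.three_unique (hs _) (hs _) (hs _) (t := fun i => (x (E i))⁻¹)
    (t' := fun i => (x' (E i))⁻¹) (by
      convert he.comp E hE using 1
      ext a; fin_cases a <;> rfl) (fun i => inv_ne_zero (hx _ (hES _))) h0 h h'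
  refine ⟨a⁻¹, ?_⟩
  rw [hsum, hsum, Finset.smul_sum]
  refine Finset.sum_congr rfl fun i _ => ?_
  have := ha i
  rw [inv_eq_iff_eq_inv, mul_inv, inv_inv] at this
  rw [this, mul_smul]

end Supports

section Basis

variable (e : Module.Basis (Fin 5) k V)

theorem cub_basis (hs : ∀ i, IsSing c (e i)) (x : Fin 5 → k) :
    cub c (∑ i, x i • e i) =
      x 0 * x 1 * x 2 * pol c (e 0) (e 1) (e 2) + x 0 * x 1 * x 3 * pol c (e 0) (e 1) (e 3) +
      x 0 * x 2 * x 3 * pol c (e 0) (e 2) (e 3) + x 1 * x 2 * x 3 * pol c (e 1) (e 2) (e 3) +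
      x 0 * x 1 * x 4 * pol c (e 0) (e 1) (e 4) + x 0 * x 2 * x 4 * pol c (e 0) (e 2) (e 4) +
      x 1 * x 2 * x 4 * pol c (e 1) (e 2) (e 4) + x 0 * x 3 * x 4 * pol c (e 0) (e 3) (e 4) +
      x 1 * x 3 * x 4 * pol c (e 1) (e 3) (e 4) + x 2 * x 3 * x 4 * pol c (e 2) (e 3) (e 4) := by
  rw [Fin.sum_univ_five, cub_five (hs 0) (hs 1) (hs 2) (hs 3) (hs 4)]

theorem dcub_basis (hs : ∀ i, IsSing c (e i)) (x : Fin 5 → k) :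
    dcub c (∑ i, x i • e i) (e 0) =
      x 1 * x 2 * pol c (e 0) (e 1) (e 2) + x 1 * x 3 * pol c (e 0) (e 1) (e 3) +
      x 2 * x 3 * pol c (e 0) (e 2) (e 3) + x 1 * x 4 * pol c (e 0) (e 1) (e 4) +
      x 2 * x 4 * pol c (e 0) (e 2) (e 4) + x 3 * x 4 * pol c (e 0) (e 3) (e 4) ∧
    dcub c (∑ i, x i • e i) (e 1) =
      x 0 * x 2 * pol c (e 0) (e 1) (e 2) + x 0 * x 3 * pol c (e 0) (e 1) (e 3) +
      x 2 * x 3 * pol c (e 1) (e 2) (e 3) + x 0 * x 4 * pol c (e 0) (e 1) (e 4) +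
      x 2 * x 4 * pol c (e 1) (e 2) (e 4) + x 3 * x 4 * pol c (e 1) (e 3) (e 4) ∧
    dcub c (∑ i, x i • e i) (e 2) =
      x 0 * x 1 * pol c (e 0) (e 1) (e 2) + x 0 * x 3 * pol c (e 0) (e 2) (e 3) +
      x 1 * x 3 * pol c (e 1) (e 2) (e 3) + x 0 * x 4 * pol c (e 0) (e 2) (e 4) +
      x 1 * x 4 * pol c (e 1) (e 2) (e 4) + x 3 * x 4 * pol c (e 2) (e 3) (e 4) ∧
    dcub c (∑ i, x i • e i) (e 3) =
      x 0 * x 1 * pol c (e 0) (e 1) (e 3) + x 0 * x 2 * pol c (e 0) (e 2) (e 3) +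
      x 1 * x 2 * pol c (e 1) (e 2) (e 3) + x 0 * x 4 * pol c (e 0) (e 3) (e 4) +
      x 1 * x 4 * pol c (e 1) (e 3) (e 4) + x 2 * x 4 * pol c (e 2) (e 3) (e 4) ∧
    dcub c (∑ i, x i • e i) (e 4) =
      x 0 * x 1 * pol c (e 0) (e 1) (e 4) + x 0 * x 2 * pol c (e 0) (e 2) (e 4) +
      x 1 * x 2 * pol c (e 1) (e 2) (e 4) + x 0 * x 3 * pol c (e 0) (e 3) (e 4) +
      x 1 * x 3 * pol c (e 1) (e 3) (e 4) + x 2 * x 3 * pol c (e 2) (e 3) (e 4) := by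
  have s2 : ∀ i j, pol c (e i) (e j) (e j) = 0 := fun i j => (hs j).pol_self_right _
  have s3 : ∀ i j, pol c (e i) (e j) (e i) = 0 := fun i j => (hs i).pol_self_outer _
  have r : ∀ i j l, pol c (e i) (e j) (e l) = pol c (e l) (e i) (e j) := fun i j l =>
    (pol_swap₂₃ _ _ _).trans (pol_swap₁₂ _ _ _)
  have m : ∀ i j l, pol c (e i) (e j) (e l) = pol c (e i) (e l) (e j) := fun i j l =>
    pol_swap₂₃ _ _ _
  rw [Fin.sum_univ_five]
  simp only [dcub_five (hs 0) (hs 1) (hs 2) (hs 3) (hs 4), s2, s3]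
  refine ⟨?_, ?_, ?_, ?_, ?_⟩
  · rw [r 1 2 0, r 1 3 0, r 2 3 0, r 1 4 0, r 2 4 0, r 3 4 0]; ring
  · rw [m 0 2 1, m 0 3 1, m 0 4 1, r 2 3 1, r 2 4 1, r 3 4 1]; ring
  · rw [m 0 3 2, m 1 3 2, m 0 4 2, m 1 4 2, r 3 4 2]; ring
  · rw [m 0 4 3, m 1 4 3, m 2 4 3]; ring
  · ring

theorem isSing_of_basis {v : V} (h0 : cub c v = 0) (h : ∀ i, dcub c v (e i) = 0) :
    IsSing c v := by
  refine ⟨h0, fun w => ?_⟩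
  rw [← e.sum_repr w, Fin.sum_univ_five]
  simp [dcub_add_right, dcub_smul_right, h]

/-- Among the singular points in general position with respect to a projective frame of singular
points there is at most one. -/
theorem IsolatedSing.five_proportional (hc : IsolatedSing c) (hs : ∀ i, IsSing c (e i))
    {x x' : Fin 5 → k} (hx : ∀ i, x i ≠ 0) (hx' : ∀ i, x' i ≠ 0)
    (hv : IsSing c (∑ i, x i • e i)) (hv' : IsSing c (∑ i, x' i • e i)) :
    ∃ a : k, ∑ i, x' i • e i = a • ∑ i, x i • e i := by
  set T012 := pol c (e 0) (e 1) (e 2) with h012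
  set T013 := pol c (e 0) (e 1) (e 3) with h013
  set T014 := pol c (e 0) (e 1) (e 4) with h014
  set T023 := pol c (e 0) (e 2) (e 3) with h023
  set T024 := pol c (e 0) (e 2) (e 4) with h024
  set T034 := pol c (e 0) (e 3) (e 4) with h034
  set T123 := pol c (e 1) (e 2) (e 3) with h123
  set T124 := pol c (e 1) (e 2) (e 4) with h124
  set T134 := pol c (e 1) (e 3) (e 4) with h134
  set T234 := pol c (e 2) (e 3) (e 4) with h234
  -- In the inverse coordinates `t` the cubic becomes a quadric, and its singular points become
  -- those of the quadric: the five linear equations are the partial derivatives of the last one.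
  -- The quadric itself is listed because Euler's relation does not yield it in characteristic 2.
  have lin : ∀ t : Fin 5 → k, (∀ i, t i ≠ 0) → (IsSing c (∑ i, (t i)⁻¹ • e i) ↔
      (t 1 * T234 + t 2 * T134 + t 3 * T124 + t 4 * T123 = 0 ∧
       t 0 * T234 + t 2 * T034 + t 3 * T024 + t 4 * T023 = 0 ∧
       t 0 * T134 + t 1 * T034 + t 3 * T014 + t 4 * T013 = 0 ∧
       t 0 * T124 + t 1 * T024 + t 2 * T014 + t 4 * T012 = 0 ∧
       t 0 * T123 + t 1 * T023 + t 2 * T013 + t 3 * T012 = 0 ∧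
       t 0 * t 1 * T234 + t 0 * t 2 * T134 + t 0 * t 3 * T124 + t 0 * t 4 * T123 +
       t 1 * t 2 * T034 + t 1 * t 3 * T024 + t 1 * t 4 * T023 +
       t 2 * t 3 * T014 + t 2 * t 4 * T013 + t 3 * t 4 * T012 = 0)) := by
    intro t ht
    have t0 := ht 0
    have t1 := ht 1
    have t2 := ht 2
    have t3 := ht 3
    have t4 := ht 4
    obtain ⟨e0, e1, e2, e3, e4⟩ := dcub_basis e hs (fun i => (t i)⁻¹)
    have ef := cub_basis e hs (fun i => (t i)⁻¹)
    simp only [← h012, ← h013, ← h014, ← h023, ← h024, ← h034, ← h123, ← h124, ← h134, ← h234]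
      at e0 e1 e2 e3 e4 ef
    constructor
    · intro h
      have d0 := h.dcub_eq (e 0)
      have d1 := h.dcub_eq (e 1)
      have d2 := h.dcub_eq (e 2)
      have d3 := h.dcub_eq (e 3)
      have d4 := h.dcub_eq (e 4)
      have f := h.cub_eq
      rw [e0] at d0
      rw [e1] at d1
      rw [e2] at d2
      rw [e3] at d3
      rw [e4] at d4
      rw [ef] at f
      clear e0 e1 e2 e3 e4 ef
      field_simp at d0 d1 d2 d3 d4 f
      refine ⟨?_, ?_, ?_, ?_, ?_, ?_⟩
      · exact mul_left_cancel₀ t0 (by linear_combination f - d0)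
      · exact mul_left_cancel₀ t1 (by linear_combination f - d1)
      · exact mul_left_cancel₀ t2 (by linear_combination f - d2)
      · exact mul_left_cancel₀ t3 (by linear_combination f - d3)
      · exact mul_left_cancel₀ t4 (by linear_combination f - d4)
      · linear_combination f
    · rintro ⟨d0, d1, d2, d3, d4, f⟩
      refine isSing_of_basis e ?_ fun i => ?_
      · rw [ef]; field_simp; linear_combination f
      · fin_cases i
        · change dcub c _ (e 0) = 0
          rw [e0]; field_simp; linear_combination f - t 0 * d0
        · change dcub c _ (e 1) = 0
          rw [e1]; field_simp; linear_combination f - t 1 * d1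
        · change dcub c _ (e 2) = 0
          rw [e2]; field_simp; linear_combination f - t 2 * d2
        · change dcub c _ (e 3) = 0
          rw [e3]; field_simp; linear_combination f - t 3 * d3
        · change dcub c _ (e 4) = 0
          rw [e4]; field_simp; linear_combination f - t 4 * d4
  by_contra! hn
  refine hc.not_inv_line e.linearIndependent (t := fun i => (x i)⁻¹) (t' := fun i => (x' i)⁻¹)
    (fun i => inv_ne_zero (hx i)) ?_ ?_
  · intro a b hab
    by_cases hb : b = 0
    · subst hb
      have := hab 0
      simp [hx 0] at this
      simp [this]
    by_cases ha : a = 0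
    · subst ha
      have := hab 0
      simp [hx' 0] at this
      simp [this]
    refine absurd ?_ (hn (-b / a))
    rw [Finset.smul_sum]
    refine Finset.sum_congr rfl fun i _ => ?_
    rw [smul_smul]
    congr 1
    have h1 := hab i
    have := hx i
    have := hx' i
    field_simp at h1 ⊢
    linear_combination h1
  · intro s hst
    obtain ⟨a0, a1, a2, a3, a4, af⟩ := (lin (fun i => (x i)⁻¹) (fun i => inv_ne_zero (hx i))).1
      (by simpa using hv)
    obtain ⟨b0, b1, b2, b3, b4, bf⟩ := (lin (fun i => (x' i)⁻¹) (fun i => inv_ne_zero (hx' i))).1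
      (by simpa using hv')
    refine (lin _ hst).2 ⟨?_, ?_, ?_, ?_, ?_, ?_⟩
    · linear_combination a0 + s * b0
    · linear_combination a1 + s * b1
    · linear_combination a2 + s * b2
    · linear_combination a3 + s * b3
    · linear_combination a4 + s * b4
    -- The cross term of the quadric on the line is the sum of its partial derivatives at the first
    -- point, weighted by the coordinates of the second.
    · linear_combination af + s ^ 2 * bf + s * ((x' 0)⁻¹ * a0 + (x' 1)⁻¹ * a1 + (x' 2)⁻¹ * a2 +
        (x' 3)⁻¹ * a3 + (x' 4)⁻¹ * a4)

end Basis
end Frames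

/-! ### Factorization of the cubic for each graph of faces. -/

section Cases

variable {k V : Type*} [Field k] [AddCommGroup V] [Module k V] {c : V →ₗ[k] V →ₗ[k] V →ₗ[k] k}

variable (c) in
/-- There is a singular point in general position on the coordinate plane opposite to `l, m`. -/
def IsFace (e : Module.Basis (Fin 5) k V) (l m : Fin 5) : Prop :=
  ∃ x : Fin 5 → k, (∀ i, x i = 0 ↔ (i = l ∨ i = m)) ∧ IsSing c (∑ i, x i • e i)

variable (c) in
/-- The cubic is a hyperplane section of a cubic `a z₀ z₁ z₂ + b z₃ z₄ z₅`, by a hyperplane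
which is normalized to `∑ zᵢ = 0`. -/
def IsPerazzoSection : Prop :=
  ∃ (h : Fin 6 → V →ₗ[k] k) (a b : k), a ≠ 0 ∧ b ≠ 0 ∧ ∑ i, h i = 0 ∧
    (∀ v, (∀ i, h i v = 0) → v = 0) ∧
    ∀ v, cub c v = a * (h 0 v * h 1 v * h 2 v) + b * (h 3 v * h 4 v * h 5 v)

variable {e : Module.Basis (Fin 5) k V}

theorem IsFace.symm {l m : Fin 5} (h : IsFace c e l m) : IsFace c e m l := by
  obtain ⟨x, hx, hs⟩ := h
  exact ⟨x, fun i => by rw [hx, or_comm], hs⟩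

/-- An edge `l, m` thus removes the coefficient of the opposite product from the cubic and gives the
inequalities that later make the linear relation have nonzero coefficients. -/
theorem IsFace.minors (hc : IsolatedSing c) (hs : ∀ i, IsSing c (e i)) {p q r l m : Fin 5}
    (hn : Function.Injective ![p, q, r, l, m]) (h : IsFace c e l m) :
    pol c (e p) (e q) (e r) = 0 ∧
      pol c (e q) (e r) (e l) * pol c (e p) (e r) (e m) -
        pol c (e p) (e r) (e l) * pol c (e q) (e r) (e m) ≠ 0 ∧
      pol c (e q) (e r) (e l) * pol c (e p) (e q) (e m) -
        pol c (e p) (e q) (e l) * pol c (e q) (e r) (e m) ≠ 0 ∧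
      pol c (e p) (e r) (e l) * pol c (e p) (e q) (e m) -
        pol c (e p) (e q) (e l) * pol c (e p) (e r) (e m) ≠ 0 := by
  obtain ⟨x, hx, hsx⟩ := h
  let E := Equiv.ofBijective _ (Finite.injective_iff_bijective.1 hn)
  have hne : ∀ i j : Fin 5, i ≠ j → ![p, q, r, l, m] i ≠ ![p, q, r, l, m] j := fun i j h h' =>
    h (hn h')
  refine hc.minors_ne_zero (hs p) (hs q) (hs r) ?_ (fun v => ?_) (x := x p) (y := x q) (z := x r)
    ?_ ?_ ?_ ?_
  · convert e.linearIndependent.comp ![p, q, r] ?_ using 1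
    · ext a; fin_cases a <;> rfl
    · intro i j hij
      have : ![p, q, r, l, m] (i.castLE (by norm_num)) = ![p, q, r, l, m] (j.castLE (by norm_num))
          := by
        fin_cases i <;> fin_cases j <;> first | rfl | simpa using hij
      simpa using hn this
  · refine ⟨e.repr v p, e.repr v q, e.repr v r, e.repr v l, e.repr v m, ?_⟩
    conv_lhs => rw [← e.sum_repr v, ← E.sum_comp, Fin.sum_univ_five]
    rfl
  · exact fun h => ((hx p).1 h).elim (hne 0 3 (by decide)) (hne 0 4 (by decide))
  · exact fun h => ((hx q).1 h).elim (hne 1 3 (by decide)) (hne 1 4 (by decide))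
  · exact fun h => ((hx r).1 h).elim (hne 2 3 (by decide)) (hne 2 4 (by decide))
  · rw [← E.sum_comp, Fin.sum_univ_five] at hsx
    change IsSing c (x p • e p + x q • e q + x r • e r + x l • e l + x m • e m) at hsx
    rw [(hx l).2 (Or.inl rfl), (hx m).2 (Or.inr rfl)] at hsx
    simpa using hsx

theorem isFace_reindex (E : Fin 5 ≃ Fin 5) (l m : Fin 5) :
    IsFace c (e.reindex E.symm) l m ↔ IsFace c e (E l) (E m) := by
  constructor
  · rintro ⟨x, hx, hs⟩
    refine ⟨x ∘ E.symm, fun i => by simp [hx, Equiv.symm_apply_eq], ?_⟩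
    rw [← E.sum_comp]
    simpa using hs
  · rintro ⟨x, hx, hs⟩
    refine ⟨x ∘ E, fun i => by simp [hx], ?_⟩
    rw [← E.sum_comp] at hs
    simpa using hs

theorem isFace_unitsSMul (u : Fin 5 → kˣ) {l m : Fin 5} (h : IsFace c e l m) :
    IsFace c (e.unitsSMul u) l m := by
  obtain ⟨x, hx, hs⟩ := h
  refine ⟨fun i => x i * ((u i)⁻¹ : kˣ), fun i => by simp [hx], ?_⟩
  convert hs using 1
  refine Finset.sum_congr rfl fun i _ => ?_
  rw [Module.Basis.unitsSMul_apply, Units.smul_def, smul_smul, mul_assoc, Units.inv_mul, mul_one]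

/-- The general form of a section of the Perazzo cubic, before normalization of the hyperplane. -/
theorem isPerazzoSection_of_relation (h : Fin 6 → V →ₗ[k] k) {a b : k} (ha : a ≠ 0) (hb : b ≠ 0)
    (r : Fin 6 → k) (hr : ∀ i, r i ≠ 0) (hsum : ∑ i, r i • h i = 0)
    (hker : ∀ v, (∀ i, h i v = 0) → v = 0)
    (hf : ∀ v, cub c v = a * (h 0 v * h 1 v * h 2 v) + b * (h 3 v * h 4 v * h 5 v)) :
    IsPerazzoSection c := by
  have h0 := hr 0
  have h1 := hr 1
  have h2 := hr 2
  have h3 := hr 3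
  have h4 := hr 4
  have h5 := hr 5
  refine ⟨fun i => r i • h i, a / (r 0 * r 1 * r 2), b / (r 3 * r 4 * r 5), ?_, ?_, hsum, ?_, ?_⟩
  · positivity
  · positivity
  · intro v hv
    exact hker v fun i => by simpa [hr i] using hv i
  · intro v
    rw [hf]
    simp only [LinearMap.smul_apply, smul_eq_mul]
    field_simp

theorem coord_ext {v : V} (h : ∀ i, e.coord i v = 0) : v = 0 :=
  e.ext_elem fun i => by simpa using h i

theorem cub_coord (hs : ∀ i, IsSing c (e i)) (v : V) : cub c v =
      e.coord 0 v * e.coord 1 v * e.coord 2 v * pol c (e 0) (e 1) (e 2) +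
      e.coord 0 v * e.coord 1 v * e.coord 3 v * pol c (e 0) (e 1) (e 3) +
      e.coord 0 v * e.coord 2 v * e.coord 3 v * pol c (e 0) (e 2) (e 3) +
      e.coord 1 v * e.coord 2 v * e.coord 3 v * pol c (e 1) (e 2) (e 3) +
      e.coord 0 v * e.coord 1 v * e.coord 4 v * pol c (e 0) (e 1) (e 4) +
      e.coord 0 v * e.coord 2 v * e.coord 4 v * pol c (e 0) (e 2) (e 4) +
      e.coord 1 v * e.coord 2 v * e.coord 4 v * pol c (e 1) (e 2) (e 4) +
      e.coord 0 v * e.coord 3 v * e.coord 4 v * pol c (e 0) (e 3) (e 4) +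
      e.coord 1 v * e.coord 3 v * e.coord 4 v * pol c (e 1) (e 3) (e 4) +
      e.coord 2 v * e.coord 3 v * e.coord 4 v * pol c (e 2) (e 3) (e 4) :=
  (congrArg (cub c) (e.sum_repr v).symm).trans (cub_basis e hs _)

theorem pol_rotate (u v w : V) : pol c u v w = pol c w u v :=
  (pol_swap₂₃ _ _ _).trans (pol_swap₁₂ _ _ _)

/-- This and the four statements below only sort the indices in `IsFace.minors`, so that the
coefficients match those in `cub_coord`. -/
theorem IsFace.minors_01 (h : IsFace c e 0 1) (hc : IsolatedSing c)
    (hs : ∀ i, IsSing c (e i)) :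
    pol c (e 2) (e 3) (e 4) = 0 ∧
      pol c (e 0) (e 3) (e 4) * pol c (e 1) (e 2) (e 4) -
        pol c (e 0) (e 2) (e 4) * pol c (e 1) (e 3) (e 4) ≠ 0 ∧
      pol c (e 0) (e 3) (e 4) * pol c (e 1) (e 2) (e 3) -
        pol c (e 0) (e 2) (e 3) * pol c (e 1) (e 3) (e 4) ≠ 0 ∧
      pol c (e 0) (e 2) (e 4) * pol c (e 1) (e 2) (e 3) -
        pol c (e 0) (e 2) (e 3) * pol c (e 1) (e 2) (e 4) ≠ 0 := by
  have := h.minors hc hs (p := 2) (q := 3) (r := 4) (by decide)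
  rwa [pol_rotate (e 3) (e 4) (e 0), pol_rotate (e 2) (e 4) (e 1), pol_rotate (e 2) (e 4) (e 0), pol_rotate (e 3) (e 4) (e 1), pol_rotate (e 2) (e 3) (e 1), pol_rotate (e 2) (e 3) (e 0)] at this

theorem IsFace.minors_12 (h : IsFace c e 1 2) (hc : IsolatedSing c)
    (hs : ∀ i, IsSing c (e i)) :
    pol c (e 0) (e 3) (e 4) = 0 ∧
      pol c (e 1) (e 3) (e 4) * pol c (e 0) (e 2) (e 4) -
        pol c (e 0) (e 1) (e 4) * pol c (e 2) (e 3) (e 4) ≠ 0 ∧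
      pol c (e 1) (e 3) (e 4) * pol c (e 0) (e 2) (e 3) -
        pol c (e 0) (e 1) (e 3) * pol c (e 2) (e 3) (e 4) ≠ 0 ∧
      pol c (e 0) (e 1) (e 4) * pol c (e 0) (e 2) (e 3) -
        pol c (e 0) (e 1) (e 3) * pol c (e 0) (e 2) (e 4) ≠ 0 := by
  have := h.minors hc hs (p := 0) (q := 3) (r := 4) (by decide)
  rwa [pol_rotate (e 3) (e 4) (e 1), pol_swap₂₃ (e 0) (e 4) (e 2), pol_swap₂₃ (e 0) (e 4) (e 1), pol_rotate (e 3) (e 4) (e 2), pol_swap₂₃ (e 0) (e 3) (e 2), pol_swap₂₃ (e 0) (e 3) (e 1)] at this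

theorem IsFace.minors_23 (h : IsFace c e 2 3) (hc : IsolatedSing c)
    (hs : ∀ i, IsSing c (e i)) :
    pol c (e 0) (e 1) (e 4) = 0 ∧
      pol c (e 1) (e 2) (e 4) * pol c (e 0) (e 3) (e 4) -
        pol c (e 0) (e 2) (e 4) * pol c (e 1) (e 3) (e 4) ≠ 0 ∧
      pol c (e 1) (e 2) (e 4) * pol c (e 0) (e 1) (e 3) -
        pol c (e 0) (e 1) (e 2) * pol c (e 1) (e 3) (e 4) ≠ 0 ∧
      pol c (e 0) (e 2) (e 4) * pol c (e 0) (e 1) (e 3) -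
        pol c (e 0) (e 1) (e 2) * pol c (e 0) (e 3) (e 4) ≠ 0 := by
  have := h.minors hc hs (p := 0) (q := 1) (r := 4) (by decide)
  rwa [pol_swap₂₃ (e 1) (e 4) (e 2), pol_swap₂₃ (e 0) (e 4) (e 3), pol_swap₂₃ (e 0) (e 4) (e 2), pol_swap₂₃ (e 1) (e 4) (e 3)] at this

theorem IsFace.minors_34 (h : IsFace c e 3 4) (hc : IsolatedSing c)
    (hs : ∀ i, IsSing c (e i)) :
    pol c (e 0) (e 1) (e 2) = 0 ∧
      pol c (e 1) (e 2) (e 3) * pol c (e 0) (e 2) (e 4) -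
        pol c (e 0) (e 2) (e 3) * pol c (e 1) (e 2) (e 4) ≠ 0 ∧
      pol c (e 1) (e 2) (e 3) * pol c (e 0) (e 1) (e 4) -
        pol c (e 0) (e 1) (e 3) * pol c (e 1) (e 2) (e 4) ≠ 0 ∧
      pol c (e 0) (e 2) (e 3) * pol c (e 0) (e 1) (e 4) -
        pol c (e 0) (e 1) (e 3) * pol c (e 0) (e 2) (e 4) ≠ 0 := by
  have := h.minors hc hs (p := 0) (q := 1) (r := 2) (by decide)
  rwa [] at this

theorem IsFace.minors_03 (h : IsFace c e 0 3) (hc : IsolatedSing c)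
    (hs : ∀ i, IsSing c (e i)) :
    pol c (e 1) (e 2) (e 4) = 0 ∧
      pol c (e 0) (e 2) (e 4) * pol c (e 1) (e 3) (e 4) -
        pol c (e 0) (e 1) (e 4) * pol c (e 2) (e 3) (e 4) ≠ 0 ∧
      pol c (e 0) (e 2) (e 4) * pol c (e 1) (e 2) (e 3) -
        pol c (e 0) (e 1) (e 2) * pol c (e 2) (e 3) (e 4) ≠ 0 ∧
      pol c (e 0) (e 1) (e 4) * pol c (e 1) (e 2) (e 3) -
        pol c (e 0) (e 1) (e 2) * pol c (e 1) (e 3) (e 4) ≠ 0 := by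
  have := h.minors hc hs (p := 1) (q := 2) (r := 4) (by decide)
  rwa [pol_rotate (e 2) (e 4) (e 0), pol_swap₂₃ (e 1) (e 4) (e 3), pol_rotate (e 1) (e 4) (e 0), pol_swap₂₃ (e 2) (e 4) (e 3), pol_rotate (e 1) (e 2) (e 0)] at this

/-- The edges 12 and 13 kill the coefficients 034 and 024, one in each term of a minor of the edge
01. -/
theorem IsolatedSing.not_star (hc : IsolatedSing c) (hs : ∀ i, IsSing c (e i))
    (h01 : IsFace c e 0 1) (h12 : IsFace c e 1 2) (h13 : IsFace c e 1 3) : False := by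
  obtain ⟨-, h, -⟩ := h01.minors_01 hc hs
  have b := (h12.minors_12 hc hs).1
  have d := (h13.minors hc hs (p := 0) (q := 2) (r := 4) (by decide)).1
  simp [b, d] at h

/-- The edges 12 and 02 kill the coefficients 034 and 134, one in each term of a minor of the edge
01. -/
theorem IsolatedSing.not_triangle (hc : IsolatedSing c) (hs : ∀ i, IsSing c (e i))
    (h01 : IsFace c e 0 1) (h12 : IsFace c e 1 2) (h02 : IsFace c e 0 2) : False := by
  obtain ⟨-, h, -⟩ := h01.minors_01 hc hs
  have b := (h12.minors_12 hc hs).1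
  have d := (h02.minors hc hs (p := 1) (q := 3) (r := 4) (by decide)).1
  simp [b, d] at h

/-- Six products of coordinates survive: three contain `x₁x₃` and three contain `x₀x₂`. This gives
the two products of linear forms, and eliminating `x₄` between their third factors gives the
relation. -/
theorem IsolatedSing.of_cycle (hc : IsolatedSing c) (hs : ∀ i, IsSing c (e i))
    (h01 : IsFace c e 0 1) (h12 : IsFace c e 1 2) (h23 : IsFace c e 2 3) (h03 : IsFace c e 0 3) :
    IsPerazzoSection c := by
  obtain ⟨b01, p1, p2, p3⟩ := h01.minors_01 hc hs
  obtain ⟨b12, q1, q2, q3⟩ := h12.minors_12 hc hs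
  obtain ⟨b23, r1, r2, r3⟩ := h23.minors_23 hc hs
  obtain ⟨b03, s1, s2, s3⟩ := h03.minors_03 hc hs
  have hf := cub_coord (e := e) hs
  simp only [b01, b12, b23, b03, mul_zero, zero_mul, sub_zero, zero_sub, neg_ne_zero, ne_eq,
    mul_eq_zero, not_or] at p1 p2 p3 q1 q2 q3 r1 r2 r3 s1 s2 s3 hf
  set T012 := pol c (e 0) (e 1) (e 2)
  set T013 := pol c (e 0) (e 1) (e 3)
  set T023 := pol c (e 0) (e 2) (e 3)
  set T024 := pol c (e 0) (e 2) (e 4)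
  set T123 := pol c (e 1) (e 2) (e 3)
  set T134 := pol c (e 1) (e 3) (e 4)
  refine isPerazzoSection_of_relation
    ![e.coord 1, e.coord 3, T134 • e.coord 4 + T123 • e.coord 2 + T013 • e.coord 0,
      e.coord 0, e.coord 2, T024 • e.coord 4 + T023 • e.coord 3 + T012 • e.coord 1]
    (a := 1) (b := 1) one_ne_zero one_ne_zero
    ![T134 * T012, T134 * T023, T024, -(T024 * T013), -(T024 * T123), -T134] ?_ ?_ ?_ ?_
  · intro i
    fin_cases i <;> simp_all
  · simp only [Fin.sum_univ_six, Matrix.cons_val]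
    module
  · intro v hv
    have v0 := hv 3
    have v1 := hv 0
    have v2 := hv 4
    have v3 := hv 1
    have v4 := hv 2
    simp only [Matrix.cons_val] at v0 v1 v2 v3
    simp only [Matrix.cons_val, LinearMap.add_apply, LinearMap.smul_apply, v0, v2, smul_eq_mul,
      mul_zero, add_zero, mul_eq_zero] at v4
    refine coord_ext (e := e) fun i => ?_
    fin_cases i
    exacts [v0, v1, v2, v3, v4.resolve_left (by tauto)]
  · intro v
    rw [hf]
    simp only [Matrix.cons_val, LinearMap.add_apply, LinearMap.smul_apply, smul_eq_mul]
    ring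

/-- The surviving terms with `x₂` form `x₂` times a quadric in the other coordinates. Changing its
`x₁x₃` coefficient makes that quadric a product of two linear forms; the correction goes into the
product that contains `x₁x₃`. -/
theorem IsolatedSing.of_path (hc : IsolatedSing c) (hs : ∀ i, IsSing c (e i))
    (h01 : IsFace c e 0 1) (h12 : IsFace c e 1 2) (h23 : IsFace c e 2 3) (h34 : IsFace c e 3 4) :
    IsPerazzoSection c := by
  obtain ⟨b01, p1, p2, p3⟩ := h01.minors_01 hc hs
  obtain ⟨b12, q1, q2, q3⟩ := h12.minors_12 hc hs
  obtain ⟨b23, r1, r2, r3⟩ := h23.minors_23 hc hs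
  obtain ⟨b34, s1, s2, s3⟩ := h34.minors_34 hc hs
  have hf := cub_coord (e := e) hs
  simp only [b01, b12, b23, b34, mul_zero, zero_mul, sub_zero, zero_sub, neg_ne_zero, ne_eq,
    mul_eq_zero, not_or] at p1 p2 p3 q1 q2 q3 r1 r2 r3 s1 s2 s3 hf
  set T013 := pol c (e 0) (e 1) (e 3)
  set T023 := pol c (e 0) (e 2) (e 3)
  set T024 := pol c (e 0) (e 2) (e 4)
  set T123 := pol c (e 1) (e 2) (e 3)
  set T124 := pol c (e 1) (e 2) (e 4)
  set T134 := pol c (e 1) (e 3) (e 4)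
  have hT : T024 ≠ 0 := by tauto
  have hT' : T134 ≠ 0 := by tauto
  -- The corrected coefficient is, up to the factor `T024`, a minor of the edge 01.
  have hα : T123 - T124 * T023 / T024 ≠ 0 := by
    intro h
    field_simp at h
    exact p3 (by linear_combination h)
  refine isPerazzoSection_of_relation
    ![e.coord 1, e.coord 3,
      T134 • e.coord 4 + T013 • e.coord 0 + (T123 - T124 * T023 / T024) • e.coord 2,
      e.coord 2, T124 • e.coord 1 + T024 • e.coord 0, T024 • e.coord 4 + T023 • e.coord 3]
    (a := 1) (b := T024⁻¹) one_ne_zero (inv_ne_zero hT)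
    ![T013 * T124, T134 * T023, T024, -((T123 - T124 * T023 / T024) * T024), -T013, -T134]
    ?_ ?_ ?_ ?_
  · intro i
    fin_cases i <;> simp_all
  · simp only [Fin.sum_univ_six, Matrix.cons_val]
    module
  · intro v hv
    have v1 := hv 0
    have v3 := hv 1
    have v2 := hv 3
    have v0 := hv 4
    have v4 := hv 2
    simp only [Matrix.cons_val] at v1 v2 v3
    simp only [Matrix.cons_val, LinearMap.add_apply, LinearMap.smul_apply, v1, smul_eq_mul,
      mul_zero, zero_add, mul_eq_zero, hT, false_or] at v0
    simp only [Matrix.cons_val, LinearMap.add_apply, LinearMap.smul_apply, v0, v2, smul_eq_mul,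
      mul_zero, add_zero, mul_eq_zero, hT', false_or] at v4
    refine coord_ext (e := e) fun i => ?_
    fin_cases i
    exacts [v0, v1, v2, v3, v4]
  · intro v
    rw [hf]
    simp only [Matrix.cons_val, LinearMap.add_apply, LinearMap.smul_apply, smul_eq_mul]
    field_simp
    ring

/-- The equations of the singular point `(1 : 1 : 1 : 1 : 1)`. -/
theorem IsSing.sum_basis (hs : ∀ i, IsSing c (e i)) (h : IsSing c (∑ i, e i)) :
    (pol c (e 2) (e 3) (e 4) + pol c (e 1) (e 3) (e 4) + pol c (e 1) (e 2) (e 4) +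
      pol c (e 1) (e 2) (e 3) = 0 ∧
    pol c (e 2) (e 3) (e 4) + pol c (e 0) (e 3) (e 4) + pol c (e 0) (e 2) (e 4) +
      pol c (e 0) (e 2) (e 3) = 0 ∧
    pol c (e 1) (e 3) (e 4) + pol c (e 0) (e 3) (e 4) + pol c (e 0) (e 1) (e 4) +
      pol c (e 0) (e 1) (e 3) = 0 ∧
    pol c (e 1) (e 2) (e 4) + pol c (e 0) (e 2) (e 4) + pol c (e 0) (e 1) (e 4) +
      pol c (e 0) (e 1) (e 2) = 0 ∧
    pol c (e 1) (e 2) (e 3) + pol c (e 0) (e 2) (e 3) + pol c (e 0) (e 1) (e 3) +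
      pol c (e 0) (e 1) (e 2) = 0) ∧
    pol c (e 0) (e 1) (e 2) + pol c (e 0) (e 1) (e 3) + pol c (e 0) (e 1) (e 4) +
      pol c (e 0) (e 2) (e 3) + pol c (e 0) (e 2) (e 4) + pol c (e 0) (e 3) (e 4) +
      pol c (e 1) (e 2) (e 3) + pol c (e 1) (e 2) (e 4) + pol c (e 1) (e 3) (e 4) +
      pol c (e 2) (e 3) (e 4) = 0 := by
  obtain ⟨e0, e1, e2, e3, e4⟩ := dcub_basis e hs (fun _ => 1)
  have ef := cub_basis e hs (fun _ => 1)
  simp only [one_smul, h.dcub_eq, h.cub_eq, mul_one, one_mul] at e0 e1 e2 e3 e4 ef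
  refine ⟨⟨?_, ?_, ?_, ?_, ?_⟩, ?_⟩
  · linear_combination e0 - ef
  · linear_combination e1 - ef
  · linear_combination e2 - ef
  · linear_combination e3 - ef
  · linear_combination e4 - ef
  · linear_combination -ef

/-- The linear equations at the unit point give 023 = -024 and 123 = -124, which makes a minor of
the edge 34 vanish. -/
theorem IsolatedSing.not_path_edge_unit (hc : IsolatedSing c) (hs : ∀ i, IsSing c (e i))
    (h01 : IsFace c e 0 1) (h12 : IsFace c e 1 2) (h34 : IsFace c e 3 4)
    (h : IsSing c (∑ i, e i)) : False := by
  have b01 := (h01.minors_01 hc hs).1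
  have b12 := (h12.minors_12 hc hs).1
  obtain ⟨b34, hm, -⟩ := h34.minors_34 hc hs
  obtain ⟨⟨t0, t1, t2, t3, t4⟩, q⟩ := IsSing.sum_basis hs h
  simp only [b01, b12, b34, zero_add, add_zero] at t0 t1 t2 t3 t4 q
  refine hm ?_
  have h14 : pol c (e 0) (e 2) (e 3) = -pol c (e 0) (e 2) (e 4) := by linear_combination t1
  have h04 : pol c (e 1) (e 2) (e 3) = -pol c (e 1) (e 2) (e 4) := by
    linear_combination q - t1 - t2
  rw [h14, h04]; ring

/-- Three coefficients vanish, and the equations at the unit point express the other seven through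
134 and 024. The resulting pencil consists of sums of two fixed products. -/
theorem IsolatedSing.of_path_unit (hc : IsolatedSing c) (hs : ∀ i, IsSing c (e i))
    (h01 : IsFace c e 0 1) (h12 : IsFace c e 1 2) (h23 : IsFace c e 2 3)
    (h : IsSing c (∑ i, e i)) : IsPerazzoSection c := by
  obtain ⟨b01, p1, p2, p3⟩ := h01.minors_01 hc hs
  have b12 := (h12.minors_12 hc hs).1
  have b23 := (h23.minors_23 hc hs).1
  obtain ⟨⟨t0, t1, t2, t3, t4⟩, q⟩ := IsSing.sum_basis hs h
  have hf := cub_coord (e := e) hs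
  simp only [b01, b12, b23, mul_zero, zero_mul, zero_sub, neg_ne_zero, ne_eq, zero_add,
    add_zero, mul_eq_zero, not_or] at t0 t1 t2 t3 t4 q p1 p2 p3 hf
  set T012 := pol c (e 0) (e 1) (e 2)
  set T013 := pol c (e 0) (e 1) (e 3)
  set T023 := pol c (e 0) (e 2) (e 3)
  set T024 := pol c (e 0) (e 2) (e 4)
  set T123 := pol c (e 1) (e 2) (e 3)
  set T124 := pol c (e 1) (e 2) (e 4)
  set T134 := pol c (e 1) (e 3) (e 4)
  have e14 : T023 = -T024 := by linear_combination t1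
  have e24 : T013 = -T134 := by linear_combination t2
  have e03 : T124 = -(T134 + T024) := by linear_combination q - t4
  have e04 : T123 = T024 := by linear_combination t0 - e03
  have e34 : T012 = T134 := by linear_combination t3 - e03
  refine isPerazzoSection_of_relation
    ![e.coord 1, e.coord 4 - e.coord 0, e.coord 3 - e.coord 2,
      e.coord 2, e.coord 0 - e.coord 1, e.coord 4 - e.coord 3]
    (a := T134) (b := T024) p1.2 p1.1
    ![1, 1, -1, -1, 1, -1] ?_ ?_ ?_ ?_
  · intro i
    fin_cases i <;> simp
  · simp only [Fin.sum_univ_six, Matrix.cons_val]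
    module
  · intro v hv
    have v1 := hv 0
    have v2 := hv 3
    have v3 := hv 2
    have v0 := hv 4
    have v4 := hv 5
    simp only [Matrix.cons_val] at v1 v2
    simp only [Matrix.cons_val, LinearMap.sub_apply, v1, v2, sub_zero] at v3 v0
    simp only [Matrix.cons_val, LinearMap.sub_apply, v3, sub_zero] at v4
    refine coord_ext (e := e) fun i => ?_
    fin_cases i
    exacts [v0, v1, v2, v3, v4]
  · intro v
    rw [hf, e14, e24, e03, e04, e34]
    simp only [Matrix.cons_val, LinearMap.sub_apply]
    ring

end Cases

/-! ### Graphs on five vertices, supports of singular points, and the choice of a frame. -/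

section Configuration

/-- The ten pairs of elements of `Fin 5`. -/
def pairOf : Fin 10 → Fin 5 × Fin 5 :=
  ![(0, 1), (0, 2), (0, 3), (0, 4), (1, 2), (1, 3), (1, 4), (2, 3), (2, 4), (3, 4)]

/-- The unordered pair `{a, b}` is one of the pairs with numbers in `s`. -/
def Joined (s : List (Fin 10)) (a b : Fin 5) : Prop :=
  ∃ n ∈ s, pairOf n = (a, b) ∨ pairOf n = (b, a)

instance (s : List (Fin 10)) (a b : Fin 5) : Decidable (Joined s a b) :=
  inferInstanceAs (Decidable (∃ n ∈ s, _ ∨ _))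

/-- One of the configurations that any three edges on five vertices contain. -/
theorem exists_pattern_of_three_edges : ∀ i j k : Fin 10, i < j → j < k →
    ∃ a b, Joined [i, j, k] a b ∧ ∃ c, Joined [i, j, k] b c ∧
    ∃ d f, [a, b, c, d, f].Nodup ∧
      (Joined [i, j, k] b d ∨ Joined [i, j, k] a c ∨ Joined [i, j, k] c d ∨
        Joined [i, j, k] d f) := by
  decide +kernel

/-- One of the configurations that any four edges on five vertices contain. -/
theorem exists_pattern_of_four_edges : ∀ i j k l : Fin 10, i < j → j < k → k < l →
    ∃ a b, Joined [i, j, k, l] a b ∧ ∃ c, Joined [i, j, k, l] b c ∧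
    ∃ d f, [a, b, c, d, f].Nodup ∧
      (Joined [i, j, k, l] b d ∨ Joined [i, j, k, l] a c ∨
        Joined [i, j, k, l] c d ∧ (Joined [i, j, k, l] a d ∨ Joined [i, j, k, l] d f)) := by
  decide +kernel

theorem exists_pairOf_of_card : ∀ S : Finset (Fin 5), S.card = 3 →
    ∃ n, S = Finset.univ \ {(pairOf n).1, (pairOf n).2} := by
  decide +kernel

variable {k V : Type*} [Field k] [AddCommGroup V] [Module k V] {c : V →ₗ[k] V →ₗ[k] V →ₗ[k] k}

section Rank

variable {ι : Type*} [Fintype ι] {e : ι → V} {x x' : ι → k}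

theorem sum_eq_sum_support [DecidableEq k] (x : ι → k) (e : ι → V) :
    ∑ i, x i • e i = ∑ i ∈ Finset.univ.filter (x · ≠ 0), x i • e i := by
  rw [Finset.sum_filter_of_ne]
  intro i _ h h0
  exact h (by rw [h0, zero_smul])

theorem IsolatedSing.card_support [DecidableEq k] [Module.Finite k V]
    (hV : Module.finrank k V = 5)
    (hc : IsolatedSing c) (hs : ∀ i, IsSing c (e i)) (he : LinearIndependent k e)
    (hv : IsSing c (∑ i, x i • e i)) (h0 : ∑ i, x i • e i ≠ 0) :
    (Finset.univ.filter (x · ≠ 0)).card = 1 ∨ (Finset.univ.filter (x · ≠ 0)).card = 3 ∨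
      (Finset.univ.filter (x · ≠ 0)).card = 5 := by
  have hle : Fintype.card ι ≤ 5 := hV ▸ he.fintype_card_le_finrank
  rw [sum_eq_sum_support] at hv h0
  have h1 := (Finset.card_le_univ (Finset.univ.filter (x · ≠ 0))).trans hle
  have h2 := hc.card_ne_two hs he (fun i hi => (Finset.mem_filter.1 hi).2) hv
  have h4 := hc.card_ne_four hV hs he (fun i hi => (Finset.mem_filter.1 hi).2) hv
  have h0' : (Finset.univ.filter (x · ≠ 0)).card ≠ 0 := by
    intro h
    rw [Finset.card_eq_zero.1 h] at h0
    simp at h0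
  omega

theorem IsolatedSing.proportional_of_support_eq [DecidableEq k]
    (hc : IsolatedSing c) (hs : ∀ i, IsSing c (e i)) (he : LinearIndependent k e)
    (hv : IsSing c (∑ i, x i • e i)) (hv' : IsSing c (∑ i, x' i • e i))
    (hxx' : Finset.univ.filter (x · ≠ 0) = Finset.univ.filter (x' · ≠ 0))
    (hcard : (Finset.univ.filter (x · ≠ 0)).card = 1 ∨
      (Finset.univ.filter (x · ≠ 0)).card = 3) :
    ∃ a : k, ∑ i, x' i • e i = a • ∑ i, x i • e i := by
  rw [sum_eq_sum_support] at hv hv'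
  rw [sum_eq_sum_support x, sum_eq_sum_support x', ← hxx']
  have hx : ∀ i ∈ Finset.univ.filter (x · ≠ 0), x i ≠ 0 := fun i hi => (Finset.mem_filter.1 hi).2
  have hx' : ∀ i ∈ Finset.univ.filter (x · ≠ 0), x' i ≠ 0 := fun i hi =>
    (Finset.mem_filter.1 (hxx'.subset hi)).2
  rw [← hxx'] at hv'
  rcases hcard with h | h
  · obtain ⟨j, hj⟩ := Finset.card_eq_one.1 h
    rw [hj] at hx ⊢
    have := hx j (by simp)
    exact ⟨x' j / x j, by simp [smul_smul, this]⟩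
  · exact hc.three_proportional hs he h hx hx' hv hv'

theorem not_linearIndependent_of_eq_smul {v v' : V} {a : k} (h : v' = a • v) :
    ¬ LinearIndependent k ![v, v'] := by
  intro hl
  have := LinearIndependent.pair_iff.1 hl a (-1) (by rw [h]; module)
  simp at this

/-- With `n ≤ 4` independent singular vectors there is at most one point for each support of size 1
or 3, hence at most 4 + 4 = 8 points. -/
theorem IsolatedSing.five_le_card [Module.Finite k V] (hV : Module.finrank k V = 5)
    (hc : IsolatedSing c) (hs : ∀ i, IsSing c (e i)) (he : LinearIndependent k e)
    (x : Fin 9 → ι → k) (hv : ∀ a, IsSing c (∑ i, x a i • e i))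
    (hind : ∀ a b, a ≠ b → LinearIndependent k ![∑ i, x a i • e i, ∑ i, x b i • e i]) :
    5 ≤ Fintype.card ι := by
  classical
  by_contra! hlt
  have hne : ∀ a, ∑ i, x a i • e i ≠ 0 := by
    intro a
    exact (hind a (a + 1) (by simp)).ne_zero 0
  have hodd : ∀ a, (Finset.univ.filter (x a · ≠ 0)).card = 1 ∨
      (Finset.univ.filter (x a · ≠ 0)).card = 3 := by
    intro a
    have := hc.card_support hV hs he (hv a) (hne a)
    have := Finset.card_le_univ (Finset.univ.filter (x a · ≠ 0))
    omega
  have hinj : Function.Injective fun a => Finset.univ.filter (x a · ≠ 0) := by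
    intro a b hab
    by_contra hne
    obtain ⟨r, hr⟩ := hc.proportional_of_support_eq hs he (hv a) (hv b) hab (hodd a)
    exact not_linearIndependent_of_eq_smul hr (hind a b hne)
  have hsub : Finset.univ.image (fun a => Finset.univ.filter (x a · ≠ 0)) ⊆
      Finset.powersetCard 1 Finset.univ ∪ Finset.powersetCard 3 Finset.univ := by
    intro S hS
    obtain ⟨a, -, rfl⟩ := Finset.mem_image.1 hS
    rw [Finset.mem_union, Finset.mem_powersetCard_univ, Finset.mem_powersetCard_univ]
    exact hodd a
  have h9 := (Finset.card_le_card hsub).trans (Finset.card_union_le _ _)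
  rw [Finset.card_image_of_injective _ hinj, Finset.card_powersetCard,
    Finset.card_powersetCard, Finset.card_univ, Finset.card_univ, Fintype.card_fin] at h9
  generalize Fintype.card ι = n at *
  interval_cases n <;> simp [Nat.choose] at h9

end Rank

theorem exists_singular_basis [Module.Finite k V] (hV : Module.finrank k V = 5)
    (hc : IsolatedSing c) (v : Fin 9 → V) (hv : ∀ a, IsSing c (v a))
    (hind : ∀ a b, a ≠ b → LinearIndependent k ![v a, v b]) :
    ∃ e : Module.Basis (Fin 5) k V, ∀ i, IsSing c (e i) := by
  obtain ⟨B, hB, hspan, hli⟩ := exists_linearIndependent k (Set.range v)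
  have : Finite B := (Set.finite_range v).subset hB
  have := Fintype.ofFinite B
  have hs : ∀ i : B, IsSing c i.1 := fun i => by
    obtain ⟨a, ha⟩ := hB i.2
    exact ha ▸ hv a
  have hx : ∀ a, ∃ x : B → k, ∑ i, x i • i.1 = v a := by
    intro a
    have : v a ∈ Submodule.span k (Set.range (Subtype.val : B → V)) := by
      rw [Subtype.range_coe, hspan]
      exact Submodule.subset_span ⟨a, rfl⟩
    exact (Submodule.mem_span_range_iff_exists_fun k).1 this
  choose x hx using hx
  have h5 := hc.five_le_card hV hs hli x (fun a => by rw [hx]; exact hv a)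
    (fun a b hab => by rw [hx, hx]; exact hind a b hab)
  have h5' : Fintype.card B = 5 := le_antisymm (hV ▸ hli.fintype_card_le_finrank) h5
  refine ⟨(basisOfLinearIndependentOfCardEqFinrank' _ hli (h5'.trans hV.symm)).reindex
    (Fintype.equivFinOfCardEq h5'), fun i => ?_⟩
  simpa using hs _

end Configuration

/-! ### Nine isolated singular points force a Perazzo section. -/

section Classification

variable {k V : Type*} [Field k] [AddCommGroup V] [Module k V] {c : V →ₗ[k] V →ₗ[k] V →ₗ[k] k}
  {e : Module.Basis (Fin 5) k V}

theorem isFace_of_joined {s : List (Fin 10)} {a b : Fin 5}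
    (hs : ∀ n ∈ s, IsFace c e (pairOf n).1 (pairOf n).2) (h : Joined s a b) : IsFace c e a b := by
  obtain ⟨n, hn, h | h⟩ := h
  · simpa [h] using hs n hn
  · simpa [h] using (hs n hn).symm

theorem exists_equiv_of_nodup {a b d f g : Fin 5} (h : [a, b, d, f, g].Nodup) :
    ∃ E : Fin 5 ≃ Fin 5, E 0 = a ∧ E 1 = b ∧ E 2 = d ∧ E 3 = f ∧ E 4 = g := by
  have : Function.Injective ![a, b, d, f, g] := by
    intro i j hij
    simp only [List.nodup_cons, List.mem_cons, List.not_mem_nil, not_or, or_false] at h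
    fin_cases i <;> fin_cases j <;> simp_all
  exact ⟨Equiv.ofBijective _ (Finite.injective_iff_bijective.1 this), rfl, rfl, rfl, rfl, rfl⟩

theorem IsolatedSing.of_four_faces (hc : IsolatedSing c) (hs : ∀ i, IsSing c (e i))
    {D : Finset (Fin 10)} (hD : ∀ n ∈ D, IsFace c e (pairOf n).1 (pairOf n).2) (h4 : 4 ≤ D.card) :
    IsPerazzoSection c := by
  obtain ⟨D', hD', hcard⟩ := Finset.exists_subset_card_eq h4
  let o := D'.orderEmbOfFin hcard
  have ho : ∀ i, o i ∈ D := fun i => hD' (D'.orderEmbOfFin_mem hcard i)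
  obtain ⟨a, b, hab, d, hbd, f, g, hn, h⟩ := exists_pattern_of_four_edges (o 0) (o 1) (o 2) (o 3)
    (o.strictMono (by decide)) (o.strictMono (by decide)) (o.strictMono (by decide))
  have hl : ∀ n ∈ [o 0, o 1, o 2, o 3], IsFace c e (pairOf n).1 (pairOf n).2 := by
    intro n hn
    apply hD
    simp only [List.mem_cons, List.not_mem_nil, or_false] at hn
    rcases hn with rfl | rfl | rfl | rfl <;> exact ho _
  obtain ⟨E, rfl, rfl, rfl, rfl, rfl⟩ := exists_equiv_of_nodup hn
  have hs' : ∀ i, IsSing c (e.reindex E.symm i) := fun i => by simpa using hs _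
  have key : ∀ i j, Joined [o 0, o 1, o 2, o 3] (E i) (E j) →
      IsFace c (e.reindex E.symm) i j := fun i j h =>
    (isFace_reindex E i j).2 (isFace_of_joined hl h)
  rcases h with h | h | ⟨h, h' | h'⟩
  · exact (hc.not_star hs' (key _ _ hab) (key _ _ hbd) (key _ _ h)).elim
  · exact (hc.not_triangle hs' (key _ _ hab) (key _ _ hbd) (key _ _ h)).elim
  · exact hc.of_cycle hs' (key _ _ hab) (key _ _ hbd) (key _ _ h) (key _ _ h')
  · exact hc.of_path hs' (key _ _ hab) (key _ _ hbd) (key _ _ h) (key _ _ h')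

theorem IsolatedSing.of_three_faces (hc : IsolatedSing c) (hs : ∀ i, IsSing c (e i))
    {D : Finset (Fin 10)} (hD : ∀ n ∈ D, IsFace c e (pairOf n).1 (pairOf n).2) (h3 : 3 ≤ D.card)
    {x : Fin 5 → k} (hx : ∀ i, x i ≠ 0) (hx' : IsSing c (∑ i, x i • e i)) :
    IsPerazzoSection c := by
  obtain ⟨D', hD', hcard⟩ := Finset.exists_subset_card_eq h3
  let o := D'.orderEmbOfFin hcard
  have ho : ∀ i, o i ∈ D := fun i => hD' (D'.orderEmbOfFin_mem hcard i)
  obtain ⟨a, b, hab, d, hbd, f, g, hn, h⟩ := exists_pattern_of_three_edges (o 0) (o 1) (o 2)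
    (o.strictMono (by decide)) (o.strictMono (by decide))
  have hl : ∀ n ∈ [o 0, o 1, o 2], IsFace c e (pairOf n).1 (pairOf n).2 := by
    intro n hn
    apply hD
    simp only [List.mem_cons, List.not_mem_nil, or_false] at hn
    rcases hn with rfl | rfl | rfl <;> exact ho _
  obtain ⟨E, rfl, rfl, rfl, rfl, rfl⟩ := exists_equiv_of_nodup hn
  -- Besides renaming the vertices, the frame is scaled so that the point in general position
  -- becomes the unit point.
  let e' := (e.reindex E.symm).unitsSMul fun i => Units.mk0 (x (E i)) (hx _)
  have he' : ∀ i, e' i = x (E i) • e (E i) := fun i => by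
    simp [e', Module.Basis.unitsSMul_apply, Units.smul_def]
  have hs' : ∀ i, IsSing c (e' i) := fun i => by rw [he']; exact (hs _).smul _
  have hu : IsSing c (∑ i, e' i) := by
    simp only [he']
    rwa [E.sum_comp fun i => x i • e i]
  have key : ∀ i j, Joined [o 0, o 1, o 2] (E i) (E j) →
      IsFace c e' i j := fun i j h =>
    isFace_unitsSMul _ ((isFace_reindex E i j).2 (isFace_of_joined hl h))
  rcases h with h | h | h | h
  · exact (hc.not_star hs' (key _ _ hab) (key _ _ hbd) (key _ _ h)).elim
  · exact (hc.not_triangle hs' (key _ _ hab) (key _ _ hbd) (key _ _ h)).elim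
  · exact hc.of_path_unit hs' (key _ _ hab) (key _ _ hbd) (key _ _ h) hu
  · exact (hc.not_path_edge_unit hs' (key _ _ hab) (key _ _ hbd) (key _ _ h) hu).elim

/-- A cubic threefold with isolated singularities and at least nine singular points is a
hyperplane section of the Perazzo cubic. -/
theorem IsolatedSing.isPerazzoSection [Module.Finite k V] (hV : Module.finrank k V = 5)
    (hc : IsolatedSing c) (v : Fin 9 → V) (hv : ∀ a, IsSing c (v a))
    (hind : ∀ a b, a ≠ b → LinearIndependent k ![v a, v b]) : IsPerazzoSection c := by
  classical
  obtain ⟨e, hs⟩ := exists_singular_basis hV hc v hv hind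
  let x : Fin 9 → Fin 5 → k := fun a => e.repr (v a)
  have hx : ∀ a, ∑ i, x a i • e i = v a := fun a => e.sum_repr (v a)
  let S : Fin 9 → Finset (Fin 5) := fun a => Finset.univ.filter (x a · ≠ 0)
  have hS : ∀ a i, i ∈ S a ↔ x a i ≠ 0 := fun a i => by simp [S]
  have hodd : ∀ a, (S a).card = 1 ∨ (S a).card = 3 ∨ (S a).card = 5 := fun a =>
    hc.card_support hV hs e.linearIndependent (by rw [hx]; exact hv a)
      (by rw [hx]; exact (hind a (a + 1) (by simp)).ne_zero 0)
  have huniv : ∀ a, (S a).card = 5 → S a = Finset.univ := fun a h =>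
    (Finset.card_eq_iff_eq_univ _).1 h
  have hinj : Function.Injective S := by
    intro a b hab
    by_contra hne
    suffices h : ∃ r : k, v b = r • v a from
      not_linearIndependent_of_eq_smul h.choose_spec (hind a b hne)
    rw [← hx, ← hx]
    rcases or_assoc.2 (hodd a) with h | h
    · exact hc.proportional_of_support_eq hs e.linearIndependent (by rw [hx]; exact hv a)
        (by rw [hx]; exact hv b) hab h
    · refine hc.five_proportional e hs (fun i => ?_) (fun i => ?_) (by rw [hx]; exact hv a)
        (by rw [hx]; exact hv b)
      · rw [← hS, huniv a h]; exact Finset.mem_univ i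
      · rw [← hS, ← hab, huniv a h]; exact Finset.mem_univ i
  let D : Finset (Fin 10) := Finset.univ.filter fun n => IsFace c e (pairOf n).1 (pairOf n).2
  have hD : ∀ n ∈ D, IsFace c e (pairOf n).1 (pairOf n).2 := fun n hn => (Finset.mem_filter.1 hn).2
  -- Supports that are not full are singletons, five at most, or complements of edges in `D`.
  -- Injectivity of `S` turns this into a lower bound for the number of edges.
  have hsub : ∀ a, (S a).card ≠ 5 → S a ∈ (Finset.univ.image fun i : Fin 5 => {i}) ∪
      D.image fun n => Finset.univ \ {(pairOf n).1, (pairOf n).2} := by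
    intro a h5
    rcases hodd a with h | h | h
    · obtain ⟨i, hi⟩ := Finset.card_eq_one.1 h
      rw [hi]
      exact Finset.mem_union_left _ (Finset.mem_image_of_mem _ (Finset.mem_univ i))
    · obtain ⟨n, hn⟩ := exists_pairOf_of_card _ h
      rw [hn]
      refine Finset.mem_union_right _ (Finset.mem_image_of_mem _ (Finset.mem_filter.2
        ⟨Finset.mem_univ n, x a, fun i => ?_, by rw [hx]; exact hv a⟩))
      rw [← not_iff_not, ← ne_eq, ← hS, hn]
      simp
    · exact absurd h h5
  have hcard : ((Finset.univ.image fun i : Fin 5 => ({i} : Finset (Fin 5))) ∪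
      D.image fun n => Finset.univ \ {(pairOf n).1, (pairOf n).2}).card ≤ 5 + D.card :=
    (Finset.card_union_le _ _).trans (Nat.add_le_add
      (Finset.card_image_le.trans (by simp)) Finset.card_image_le)
  -- A point with full support is unique, and the other eight need three edges; without such a point
  -- nine supports need four.
  by_cases ht : ∃ a, (S a).card = 5
  · obtain ⟨a, ha⟩ := ht
    have h9 : ((Finset.univ.erase a).image S).card ≤ _ := (Finset.card_le_card (by
      intro T hT
      obtain ⟨b, hb, rfl⟩ := Finset.mem_image.1 hT
      refine hsub b fun h => (Finset.mem_erase.1 hb).1 (hinj ?_)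
      rw [huniv a ha, huniv b h])).trans hcard
    rw [Finset.card_image_of_injective _ hinj, Finset.card_erase_of_mem (Finset.mem_univ a),
      Finset.card_univ, Fintype.card_fin] at h9
    refine hc.of_three_faces hs hD (by omega) (x := x a) (fun i => ?_) (by rw [hx]; exact hv a)
    rw [← hS, huniv a ha]; exact Finset.mem_univ i
  · push Not at ht
    have h9 : (Finset.univ.image S).card ≤ _ := (Finset.card_le_card (by
      intro T hT
      obtain ⟨b, hb, rfl⟩ := Finset.mem_image.1 hT
      exact hsub b (ht b))).trans hcard
    rw [Finset.card_image_of_injective _ hinj, Finset.card_univ, Fintype.card_fin] at h9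
    exact hc.of_four_faces hs hD (by omega)

end Classification

/-! ### From cubic forms to trilinear forms. -/

section Polynomials

open MvPolynomial

theorem exists_eq_single_add {ι : Type*} {n : ℕ} (d : ι →₀ ℕ) (h : d.degree = n + 1) :
    ∃ i d', d = Finsupp.single i 1 + d' ∧ d'.degree = n := by
  have hd : d ≠ 0 := by rintro rfl; simp at h
  obtain ⟨i, hi⟩ := Finsupp.ne_iff.1 hd
  have hle : Finsupp.single i 1 ≤ d := by
    rw [Finsupp.single_le_iff]
    exact Nat.one_le_iff_ne_zero.2 hi
  refine ⟨i, d - Finsupp.single i 1, (add_tsub_cancel_of_le hle).symm, ?_⟩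
  have := congrArg Finsupp.degree (add_tsub_cancel_of_le hle)
  rw [map_add, Finsupp.degree_single, h] at this
  omega

/-- A cubic form and its derivatives come from a trilinear form. -/
theorem exists_trilinear {ι k : Type*} [Fintype ι] [Field k] {f : MvPolynomial ι k}
    (hf : f.IsHomogeneous 3) :
    ∃ c : (ι → k) →ₗ[k] (ι → k) →ₗ[k] (ι → k) →ₗ[k] k, (∀ v, eval v f = cub c v) ∧
      ∀ v w, ∑ i, w i * eval v (pderiv i f) = dcub c v w := by
  classical
  rw [f.as_sum]
  refine Finset.sum_induction _ (fun f : MvPolynomial ι k =>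
    ∃ c : (ι → k) →ₗ[k] (ι → k) →ₗ[k] (ι → k) →ₗ[k] k, (∀ v, eval v f = cub c v) ∧
      ∀ v w, ∑ i, w i * eval v (pderiv i f) = dcub c v w) ?_ ?_ ?_
  · rintro f g ⟨c, hc, hc'⟩ ⟨d, hd, hd'⟩
    refine ⟨c + d, fun v => by simp [hc, hd, cub], fun v w => ?_⟩
    simp only [map_add, mul_add, Finset.sum_add_distrib, hc', hd', dcub, LinearMap.add_apply]
    ring
  · exact ⟨0, fun v => by simp [cub], fun v w => by simp [dcub]⟩
  · intro d hd
    have h3 : d.degree = 3 := by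
      rw [Finsupp.degree_eq_weight_one (R := ℕ)]
      exact hf (mem_support_iff.1 hd)
    obtain ⟨i, d1, rfl, h2⟩ := exists_eq_single_add d h3
    obtain ⟨j, d2, rfl, h1⟩ := exists_eq_single_add d1 h2
    obtain ⟨l, d3, rfl, h0⟩ := exists_eq_single_add d2 h1
    obtain rfl := (Finsupp.degree_eq_zero_iff d3).1 h0
    generalize coeff _ f = a
    have hm : monomial (Finsupp.single i 1 + (Finsupp.single j 1 + (Finsupp.single l 1 + 0))) a =
        C a * (X i * (X j * X l)) := by
      simp only [X, monomial_mul, C_mul_monomial, mul_one, add_zero]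
    rw [hm]
    -- The trilinear form is not symmetrized, so nothing is divided by 6.
    refine ⟨a • (LinearMap.proj i).smulRight ((LinearMap.proj j).smulRight (LinearMap.proj l)),
      fun v => by simp [cub], fun v w => ?_⟩
    simp only [pderiv_mul, pderiv_C, pderiv_X, Pi.single_apply, map_add, map_mul, eval_C, eval_X,
      mul_add, Finset.sum_add_distrib, dcub, LinearMap.smul_apply, LinearMap.smulRight_apply,
      LinearMap.proj_apply, smul_eq_mul, zero_mul, mul_zero, zero_add, map_zero,
      apply_ite (eval v), ite_mul, mul_ite, mul_one, one_mul,
      Finset.sum_ite_eq, Finset.mem_univ, if_true]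
    ring

/-- `v` is a singular vector of the form `g`. -/
def IsSingVec {ι k : Type*} [Field k] (g : MvPolynomial ι k) (v : ι → k) : Prop :=
  eval v g = 0 ∧ ∀ i, eval v (pderiv i g) = 0

theorem isSing_iff {ι k : Type*} [Fintype ι] [Field k] {f : MvPolynomial ι k}
    {c : (ι → k) →ₗ[k] (ι → k) →ₗ[k] (ι → k) →ₗ[k] k} (h : ∀ v, eval v f = cub c v)
    (h' : ∀ v w, ∑ i, w i * eval v (pderiv i f) = dcub c v w) (v : ι → k) :
    IsSing c v ↔ IsSingVec f v := by
  classical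
  constructor
  · rintro ⟨h1, h2⟩
    refine ⟨by rw [h, h1], fun i => ?_⟩
    have := h' v (Pi.single i 1)
    rw [h2] at this
    simpa [Pi.single_apply] using this
  · rintro ⟨h1, h2⟩
    exact ⟨by rw [← h, h1], fun w => by rw [← h']; simp [h2]⟩

theorem IsSingVec.smul {ι k : Type*} [Fintype ι] [Field k] {f : MvPolynomial ι k}
    (hf : f.IsHomogeneous 3) {v : ι → k} (hv : IsSingVec f v) (a : k) : IsSingVec f (a • v) := by
  obtain ⟨c, h, h'⟩ := exists_trilinear hf
  rw [← isSing_iff h h'] at hv ⊢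
  exact hv.smul a

variable {K : Type*} [Field K] {f : MvPolynomial (Fin 5) K}

theorem mk_mem_singularPoints {ι : Type*} [Fintype ι] {f : MvPolynomial ι K}
    (hf : f.IsHomogeneous 3) {v : ι → Kbar K} (hv : v ≠ 0)
    (hs : IsSingVec (geom f) v) : Projectivization.mk (Kbar K) v hv ∈ singularPoints f := by
  obtain ⟨a, ha⟩ := Projectivization.exists_smul_eq_mk_rep (Kbar K) v hv
  have := hs.smul (hf.map _) (a : Kbar K)
  change IsSingVec (geom f) _
  rw [← ha]
  exact this

theorem IsNineNodalCubicThreefold.finite (hf : IsNineNodalCubicThreefold f) :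
    (singularPoints f).Finite :=
  Set.finite_of_encard_eq_coe (k := 9) hf.nine

/-- The geometric structure of a nodal cubic threefold with nine nodes. -/
theorem IsNineNodalCubicThreefold.exists_forms (hf : IsNineNodalCubicThreefold f) :
    ∃ (h : Fin 6 → (Fin 5 → Kbar K) →ₗ[Kbar K] Kbar K) (a b : Kbar K), a ≠ 0 ∧ b ≠ 0 ∧
      ∑ i, h i = 0 ∧ (∀ v, (∀ i, h i v = 0) → v = 0) ∧
      ∀ v, eval v (geom f) = a * (h 0 v * h 1 v * h 2 v) + b * (h 3 v * h 4 v * h 5 v) := by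
  have hg : (geom f).IsHomogeneous 3 := hf.cubic.homogeneous.map _
  obtain ⟨c, h, h'⟩ := exists_trilinear hg
  -- A one-parameter family would embed a cofinite, hence infinite, set of parameters into the nine
  -- singular points.
  have hiso : IsolatedSing c := by
    intro Z hZ φ hφ hind
    have hne : ∀ s ∉ Z, φ s ≠ 0 := by
      intro s hs h0
      obtain ⟨s', hs'⟩ := (hZ.union (Set.finite_singleton s)).infinite_compl.nonempty
      simp only [Set.mem_compl_iff, Set.mem_union, Set.mem_singleton_iff, not_or] at hs'
      have := (hind s hs s' hs'.1 (Ne.symm hs'.2) 1 0 (by simp [h0])).1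
      exact one_ne_zero this
    have hinf := hZ.infinite_compl
    refine hinf ?_
    have : Finite (singularPoints f) := hf.finite
    let F : (Zᶜ : Set (Kbar K)) → singularPoints f := fun s =>
      ⟨Projectivization.mk _ (φ s) (hne s s.2), mk_mem_singularPoints hf.cubic.homogeneous _
        ((isSing_iff h h' _).1 (hφ s s.2))⟩
    have hF : Function.Injective F := by
      intro s s' hss
      by_contra hne'
      obtain ⟨a, ha⟩ := (Projectivization.mk_eq_mk_iff' _ _ _ _ _).1 (Subtype.ext_iff.1 hss)
      have := (hind s s.2 s' s'.2 (fun h => hne' (Subtype.ext h)) 1 (-a) (by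
        rw [← ha]; module)).1
      exact one_ne_zero this
    exact Finite.of_injective F hF
  have hcard : Nat.card (singularPoints f) = 9 := by
    rw [Nat.card_coe_set_eq, Set.ncard, hf.nine]; rfl
  have : Finite (singularPoints f) := hf.finite
  let E := (Finite.equivFinOfCardEq hcard).symm
  obtain ⟨l, a, b, ha, hb, hsum, hker, hl⟩ := hiso.isPerazzoSection (by simp)
    (fun i => (E i).1.rep) (fun i => (isSing_iff h h' _).2 (E i).2) (by
      intro i j hij
      have : (E i).1 ≠ (E j).1 := fun h => hij (E.injective (Subtype.ext h))
      rw [← Projectivization.independent_pair_iff_ne, Projectivization.independent_iff] at this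
      convert this using 1
      ext m; fin_cases m <;> rfl)
  exact ⟨l, a, b, ha, hb, hsum, hker, fun v => by rw [h, hl]⟩

end Polynomials

/-! ### The six linear forms and their nine nodes. -/

section Hyperplanes

open Matrix

variable {k : Type*} [Field k] {H : Fin 6 → Fin 5 → k}

/-- The six forms embed the 5-space into the hyperplane of vectors with coordinate sum zero, which
also has dimension five. -/
theorem exists_dotProduct_eq (hsum : ∑ i, H i = 0) (hker : ∀ v, (∀ i, H i ⬝ᵥ v = 0) → v = 0)
    {γ : Fin 6 → k} (hγ : ∑ i, γ i = 0) : ∃ v, ∀ i, H i ⬝ᵥ v = γ i := by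
  let L : (Fin 5 → k) →ₗ[k] (Fin 6 → k) := Matrix.mulVecLin (Matrix.of H)
  have hL : ∀ v i, L v i = H i ⬝ᵥ v := fun v i => rfl
  let s : (Fin 6 → k) →ₗ[k] k := ∑ i, LinearMap.proj i
  have hs : ∀ z, s z = ∑ i, z i := fun z => by simp [s]
  have hle : LinearMap.range L ≤ LinearMap.ker s := by
    rintro _ ⟨v, rfl⟩
    rw [LinearMap.mem_ker, hs]
    simp only [hL]
    rw [← sum_dotProduct, hsum, zero_dotProduct]
  have hinj : Function.Injective L := by
    rw [← LinearMap.ker_eq_bot, LinearMap.ker_eq_bot']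
    intro v hv
    exact hker v fun i => by rw [← hL, hv]; rfl
  have h1 : Module.finrank k (LinearMap.range L) = 5 := by
    rw [LinearMap.finrank_range_of_inj hinj]; simp
  have hsurj : Function.Surjective s := fun a => ⟨Pi.single 0 a, by simp [hs]⟩
  have h2 : Module.finrank k (LinearMap.ker s) = 5 := by
    have := s.finrank_range_add_finrank_ker
    rw [LinearMap.range_eq_top.2 hsurj] at this
    simp at this
    omega
  have := Submodule.eq_of_le_of_finrank_eq hle (h1.trans h2.symm)
  have hm : γ ∈ LinearMap.range L := by
    rw [this, LinearMap.mem_ker, hs, hγ]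
  obtain ⟨v, hv⟩ := hm
  exact ⟨v, fun i => by rw [← hL, hv]⟩

theorem exists_coeffs (hker : ∀ v, (∀ i, H i ⬝ᵥ v = 0) → v = 0) (g : Fin 5 → k) :
    ∃ γ : Fin 6 → k, ∀ v, g ⬝ᵥ v = ∑ i, γ i * (H i ⬝ᵥ v) := by
  let L : (Fin 5 → k) →ₗ[k] (Fin 6 → k) := Matrix.mulVecLin (Matrix.of H)
  have hL : ∀ v i, L v i = H i ⬝ᵥ v := fun v i => rfl
  have hinj : LinearMap.ker L = ⊥ := by
    rw [LinearMap.ker_eq_bot']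
    intro v hv
    exact hker v fun i => by rw [← hL, hv]; rfl
  obtain ⟨R, hR⟩ := L.exists_leftInverse_of_injective hinj
  refine ⟨fun i => g ⬝ᵥ R (Pi.single i 1), fun v => ?_⟩
  have : R (L v) = v := LinearMap.congr_fun hR v
  conv_lhs => rw [← this, ← Finset.univ_sum_single (L v), map_sum, dotProduct_sum]
  refine Finset.sum_congr rfl fun i _ => ?_
  have h1 : Pi.single i (L v i) = L v i • (Pi.single i 1 : Fin 6 → k) := by
    rw [← Pi.single_smul, smul_eq_mul, mul_one]
  rw [h1, map_smul, dotProduct_smul, smul_eq_mul, hL, mul_comm]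

/-- The `i`-th element of the side `{0, 1, 2}` of `Fin 6`. -/
abbrev onLeft (i : Fin 3) : Fin 6 := Fin.castAdd 3 i

/-- The `i`-th element of the side `{3, 4, 5}` of `Fin 6`. -/
abbrev onRight (i : Fin 3) : Fin 6 := Fin.natAdd 3 i

/-- The closure condition makes the bipartite graph a disjoint union of complete bipartite graphs.
With six of the nine edges, one component contains a complete graph on two and three vertices. -/
theorem exists_cross_of_six_le : ∀ e : Fin 3 → Fin 3 → Bool,
    (∀ i j i' j', e i j = true → e i' j = true → e i' j' = true → e i j' = true) →
    6 ≤ (Finset.univ.filter fun x : Fin 3 × Fin 3 => e x.1 x.2 = true).card →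
    (∃ i, ∀ i', i' ≠ i → ∀ j, e i' j = true) ∨ (∃ j, ∀ j', j' ≠ j → ∀ i, e i j' = true) := by
  decide +kernel

/-- The value pattern of a function on the edges of a complete bipartite graph. -/
theorem exists_const_of_six_le {α : Type*} [DecidableEq α] (γ : Fin 6 → α)
    (h : 6 ≤ (Finset.univ.filter fun x : Fin 3 × Fin 3 =>
      γ (onLeft x.1) = γ (onRight x.2)).card) :
    ∃ m a, ∀ i, i ≠ m → γ i = a := by
  have hs : ∀ i : Fin 6, (∃ j, i = onLeft j) ∨ ∃ j, i = onRight j := by decide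
  have h1 : ∀ i : Fin 3, i + 1 ≠ i := by decide
  have := exists_cross_of_six_le (fun i j => decide (γ (onLeft i) = γ (onRight j)))
    (by
      intro i j i' j' h1 h2 h3
      simp only [decide_eq_true_eq] at h1 h2 h3 ⊢
      rw [h1, ← h2, h3]) (by simpa using h)
  simp only [decide_eq_true_eq] at this
  rcases this with ⟨i, hi⟩ | ⟨j, hj⟩
  · refine ⟨onLeft i, γ (onLeft (i + 1)), fun l hl => ?_⟩
    rcases hs l with ⟨l, rfl⟩ | ⟨l, rfl⟩
    · rw [hi l (fun h => hl (by rw [h])) 0, hi (i + 1) (h1 i) 0]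
    · rw [hi (i + 1) (h1 i) l]
  · refine ⟨onRight j, γ (onRight (j + 1)), fun l hl => ?_⟩
    rcases hs l with ⟨l, rfl⟩ | ⟨l, rfl⟩
    · rw [hj (j + 1) (h1 j) l]
    · rw [← hj l (fun h => hl (by rw [h])) 0, ← hj (j + 1) (h1 j) 0]

/-- The vector of the singular point `(i, j)`. -/
def IsNode (H : Fin 6 → Fin 5 → k) (i j : Fin 3) (v : Fin 5 → k) : Prop :=
  ∀ m, H m ⬝ᵥ v = Pi.single (M := fun _ => k) (onLeft i) 1 m - Pi.single (M := fun _ => k) (onRight j) 1 m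

theorem onLeft_ne_onRight (i j : Fin 3) : onLeft i ≠ onRight j := by
  revert i j; decide

theorem exists_node (hsum : ∑ i, H i = 0) (hker : ∀ v, (∀ i, H i ⬝ᵥ v = 0) → v = 0)
    (i j : Fin 3) : ∃ v, IsNode H i j v := by
  refine exists_dotProduct_eq hsum hker ?_
  rw [Finset.sum_sub_distrib, Finset.sum_pi_single', Finset.sum_pi_single']
  simp

theorem IsNode.left {i j : Fin 3} {v : Fin 5 → k} (h : IsNode H i j v) (i' : Fin 3) :
    H (onLeft i') ⬝ᵥ v = if i' = i then 1 else 0 := by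
  rw [h, Pi.single_apply, Pi.single_eq_of_ne (onLeft_ne_onRight _ _), sub_zero]
  simp [onLeft, Fin.ext_iff]

theorem IsNode.right {i j : Fin 3} {v : Fin 5 → k} (h : IsNode H i j v) (j' : Fin 3) :
    H (onRight j') ⬝ᵥ v = if j' = j then -1 else 0 := by
  rw [h, Pi.single_apply, Pi.single_apply, if_neg (onLeft_ne_onRight _ _).symm, zero_sub]
  simp only [onRight, Fin.ext_iff, Fin.val_natAdd, add_right_inj]
  split_ifs <;> simp

theorem IsNode.ne_zero {i j : Fin 3} {v : Fin 5 → k} (h : IsNode H i j v) : v ≠ 0 := by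
  rintro rfl
  simpa using h.left i

theorem IsNode.eq_of_smul {i j i' j' : Fin 3} {v v' : Fin 5 → k} (h : IsNode H i j v)
    (h' : IsNode H i' j' v') {t : k} (ht : v = t • v') : i = i' ∧ j = j' := by
  have h1 := h.left i
  have h2 := h.right j
  rw [ht, dotProduct_smul, h'.left] at h1
  rw [ht, dotProduct_smul, h'.right] at h2
  constructor
  · by_contra hne
    simp [hne] at h1
  · by_contra hne
    simp [hne] at h2

/-- A hyperplane through six of the nine nodes is one of the six given ones. -/
theorem exists_eq_smul_of_six_le [DecidableEq k] (hsum : ∑ i, H i = 0)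
    (hker : ∀ v, (∀ i, H i ⬝ᵥ v = 0) → v = 0) {P : Fin 3 × Fin 3 → Fin 5 → k}
    (hP : ∀ x, IsNode H x.1 x.2 (P x)) {g : Fin 5 → k}
    (h6 : 6 ≤ (Finset.univ.filter fun x => g ⬝ᵥ P x = 0).card) : ∃ (m : Fin 6) (a : k), g = a • H m := by
  obtain ⟨γ, hγ⟩ := exists_coeffs hker g
  have hval : ∀ x, g ⬝ᵥ P x = γ (onLeft x.1) - γ (onRight x.2) := by
    rintro ⟨i, j⟩
    rw [hγ]
    simp only [hP (i, j) _, mul_sub, Finset.sum_sub_distrib, Pi.single_apply, mul_ite, mul_one,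
      mul_zero, Finset.sum_ite_eq', Finset.mem_univ, if_true]
  simp only [hval, sub_eq_zero] at h6
  obtain ⟨m, a, hm⟩ := exists_const_of_six_le γ h6
  refine ⟨m, γ m - a, dotProduct_eq _ _ fun v => ?_⟩
  -- As the forms add up to zero, the common value `a` can be subtracted from every coefficient.
  have h0 : ∑ i, H i ⬝ᵥ v = 0 := by rw [← sum_dotProduct, hsum, zero_dotProduct]
  calc g ⬝ᵥ v = ∑ i, (γ i - a) * (H i ⬝ᵥ v) := by
        simp only [sub_mul, Finset.sum_sub_distrib, ← Finset.mul_sum, h0, hγ, mul_zero, sub_zero]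
    _ = (γ m - a) * (H m ⬝ᵥ v) := by
        refine Finset.sum_eq_single m (fun i _ hi => by rw [hm i hi, sub_self, zero_mul]) ?_
        simp
    _ = _ := by rw [smul_dotProduct, smul_eq_mul]

/-- A form is nonzero at exactly the three nodes whose label involves its index. Together with
`exists_eq_smul_of_six_le` this describes the six hyperplanes through the nodes alone. -/
theorem card_nodes_on [DecidableEq k] {P : Fin 3 × Fin 3 → Fin 5 → k}
    (hP : ∀ x, IsNode H x.1 x.2 (P x)) (m : Fin 6) :
    (Finset.univ.filter fun x => H m ⬝ᵥ P x = 0).card = 6 := by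
  have : ∀ x, H m ⬝ᵥ P x = 0 ↔ (m ≠ onLeft x.1 ∧ m ≠ onRight x.2) := by
    intro x
    rw [hP x m, Pi.single_apply, Pi.single_apply]
    have := onLeft_ne_onRight x.1 x.2
    split_ifs <;> simp_all
  simp only [this]
  clear this
  revert m
  decide

end Hyperplanes

/-! ### Scaling of vectors compatible with field automorphisms. -/

section Normalize

variable {k : Type*} [Field k]

open Classical in
/-- The first nonzero coordinate of a vector. -/
def lead (w : Fin 5 → k) : k :=
  if w 0 ≠ 0 then w 0 else if w 1 ≠ 0 then w 1 else if w 2 ≠ 0 then w 2 else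
    if w 3 ≠ 0 then w 3 else w 4

theorem lead_ne_zero {w : Fin 5 → k} (hw : w ≠ 0) : lead w ≠ 0 := by
  contrapose! hw
  unfold lead at hw
  split_ifs at hw with h0 h1 h2 h3
  · exact absurd hw h0
  · exact absurd hw h1
  · exact absurd hw h2
  · exact absurd hw h3
  · ext i
    fin_cases i <;> simp_all

theorem lead_smul {t : k} (ht : t ≠ 0) (w : Fin 5 → k) : lead (t • w) = t * lead w := by
  unfold lead
  simp only [Pi.smul_apply, smul_eq_mul]
  split_ifs <;> simp_all

theorem lead_map (σ : k →+* k) (w : Fin 5 → k) : lead (fun j => σ (w j)) = σ (lead w) := by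
  unfold lead
  split_ifs <;> simp_all

end Normalize

/-! ### The Galois action on nodes and linear forms. -/

section Galois

open MvPolynomial Matrix

/-- At a node two factors of each product vanish, so both products vanish to second order. -/
theorem isSingVec_of_isNode {k : Type*} [Field k] [Infinite k] {H : Fin 6 → Fin 5 → k}
    {g : MvPolynomial (Fin 5) k} {a b : k}
    (hg : ∀ v, eval v g = a * (H 0 ⬝ᵥ v * H 1 ⬝ᵥ v * H 2 ⬝ᵥ v) +
      b * (H 3 ⬝ᵥ v * H 4 ⬝ᵥ v * H 5 ⬝ᵥ v)) {i j : Fin 3} {v : Fin 5 → k}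
    (hv : IsNode H i j v) : IsSingVec g v := by
  let Λ : Fin 6 → MvPolynomial (Fin 5) k := fun i => ∑ j, C (H i j) * X j
  have hΛ : ∀ i v, eval v (Λ i) = H i ⬝ᵥ v := fun i v => by simp [Λ, dotProduct]
  have hg' : g = C a * (Λ 0 * Λ 1 * Λ 2) + C b * (Λ 3 * Λ 4 * Λ 5) :=
    MvPolynomial.funext fun v => by simp [hg, hΛ]
  have hl := hv.left
  have hr := hv.right
  have l0 := hl 0
  have l1 := hl 1
  have l2 := hl 2
  have r0 := hr 0
  have r1 := hr 1
  have r2 := hr 2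
  change H 0 ⬝ᵥ v = _ at l0
  change H 1 ⬝ᵥ v = _ at l1
  change H 2 ⬝ᵥ v = _ at l2
  change H 3 ⬝ᵥ v = _ at r0
  change H 4 ⬝ᵥ v = _ at r1
  change H 5 ⬝ᵥ v = _ at r2
  constructor
  · rw [hg, l0, l1, l2, r0, r1, r2]
    fin_cases i <;> fin_cases j <;> simp
  · intro x
    simp only [hg', pderiv_mul, pderiv_C, map_add, map_mul, hΛ, eval_C, l0, l1, l2, r0, r1, r2]
    fin_cases i <;> fin_cases j <;> simp

variable {K : Type*} [Field K]

theorem IsSingVec.conj {ι : Type*} {f : MvPolynomial ι K} {v : ι → Kbar K}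
    (hv : IsSingVec (geom f) v) (σ : Kbar K ≃ₐ[K] Kbar K) :
    IsSingVec (geom f) (fun j => σ (v j)) := by
  have key : ∀ g : MvPolynomial ι K, eval (fun j => σ (v j)) (geom g) = σ (eval v (geom g)) := by
    intro g
    simp only [geom, eval_map, ← aeval_def]
    exact (comp_aeval_apply v σ.toAlgHom g).symm
  refine ⟨by rw [key, hv.1, map_zero], fun i => ?_⟩
  have := hv.2 i
  rw [geom, pderiv_map] at this ⊢
  change eval _ (geom _) = 0
  change eval _ (geom _) = 0 at this
  rw [key, this, map_zero]

/-- The linear forms of a nine-nodal cubic threefold can be chosen such that they are permuted by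
the Galois group. -/
theorem IsNineNodalCubicThreefold.exists_galois_forms {f : MvPolynomial (Fin 5) K}
    (hf : IsNineNodalCubicThreefold f) :
    ∃ (N : Fin 6 → Fin 5 → Kbar K) (r : Fin 6 → Kbar K) (a b : Kbar K), a ≠ 0 ∧ b ≠ 0 ∧
      (∀ i, r i ≠ 0) ∧ ∑ i, r i • N i = 0 ∧ (∀ v, (∀ i, N i ⬝ᵥ v = 0) → v = 0) ∧
      Function.Injective N ∧
      (∀ v, eval v (geom f) = a * (N 0 ⬝ᵥ v * N 1 ⬝ᵥ v * N 2 ⬝ᵥ v) +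
        b * (N 3 ⬝ᵥ v * N 4 ⬝ᵥ v * N 5 ⬝ᵥ v)) ∧
      ∀ σ : Kbar K ≃ₐ[K] Kbar K, ∃ π : Fin 6 ≃ Fin 6, ∀ m, (fun j => σ (N m j)) = N (π m) := by
  classical
  obtain ⟨h, a, b, ha, hb, hsum', hker', hF⟩ := hf.exists_forms
  let H : Fin 6 → Fin 5 → Kbar K := fun i j => h i (Pi.single j 1)
  have hH : ∀ i v, h i v = H i ⬝ᵥ v := by
    intro i v
    conv_lhs => rw [← Finset.univ_sum_single v, map_sum]
    refine Finset.sum_congr rfl fun j _ => ?_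
    have h1 : Pi.single j (v j) = v j • (Pi.single j 1 : Fin 5 → Kbar K) := by
      rw [← Pi.single_smul, smul_eq_mul, mul_one]
    rw [h1, map_smul, smul_eq_mul, mul_comm]
  simp only [hH] at hker' hF
  have hsum : ∑ i, H i = 0 := by
    ext j
    have := LinearMap.congr_fun hsum' (Pi.single j 1)
    simpa [H, Finset.sum_apply] using this
  choose P hP using fun x : Fin 3 × Fin 3 => exists_node hsum hker' x.1 x.2
  have hPs : ∀ x, IsSingVec (geom f) (P x) := fun x => isSingVec_of_isNode hF (hP x)
  let Φ : Fin 3 × Fin 3 → singularPoints f := fun x =>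
    ⟨Projectivization.mk _ (P x) (hP x).ne_zero,
      mk_mem_singularPoints hf.cubic.homogeneous _ (hPs x)⟩
  have hprop : ∀ x y (t : Kbar K), P x = t • P y → x = y := fun x y t h => by
    obtain ⟨h1, h2⟩ := (hP x).eq_of_smul (hP y) h
    exact Prod.ext h1 h2
  have hΦ : Function.Injective Φ := by
    intro x y hxy
    obtain ⟨t, ht⟩ := (Projectivization.mk_eq_mk_iff' _ _ _ _ _).1 (Subtype.ext_iff.1 hxy)
    exact hprop x y t ht.symm
  have : Finite (singularPoints f) := hf.finite
  -- Nine distinct nodes exhaust the nine singular points.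
  have hΦ' : Function.Surjective Φ := by
    refine ((Nat.bijective_iff_injective_and_card Φ).2 ⟨hΦ, ?_⟩).2
    rw [Nat.card_coe_set_eq, Set.ncard, hf.nine]
    simp
  have hall : ∀ v : Fin 5 → Kbar K, v ≠ 0 → IsSingVec (geom f) v → ∃ x, ∃ t : Kbar K, t • P x = v :=
    by
    intro v hv hs
    obtain ⟨x, hx⟩ := hΦ' ⟨_, mk_mem_singularPoints hf.cubic.homogeneous hv hs⟩
    exact ⟨x, (Projectivization.mk_eq_mk_iff' _ _ _ _ _).1 (Subtype.ext_iff.1 hx).symm⟩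
  have hprop' : ∀ m m' (t : Kbar K), H m = t • H m' → m = m' := by
    intro m m' t ht
    by_contra hne
    obtain ⟨s, hs⟩ : ∃ s, s ≠ m ∧ s ≠ m' :=
      (by decide : ∀ m m' : Fin 6, ∃ s, s ≠ m ∧ s ≠ m') m m'
    -- At this `v` the form `H m` takes the value 1, while `H m'` vanishes.
    obtain ⟨v, hv⟩ := exists_dotProduct_eq hsum hker' (γ := Pi.single m 1 - Pi.single s 1)
      (by simp [Finset.sum_sub_distrib])
    have := hv m
    rw [ht, smul_dotProduct, hv m'] at this
    simp [Ne.symm hne, Ne.symm hs.1, Ne.symm hs.2] at this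
  have hH0 : ∀ m, H m ≠ 0 := by
    intro m h0
    obtain ⟨m', hm'⟩ : ∃ m', m ≠ m' := (by decide : ∀ m : Fin 6, ∃ m', m ≠ m') m
    exact hm' (hprop' m m' 0 (by rw [h0, zero_smul]))
  have hlead : ∀ m, lead (H m) ≠ 0 := fun m => lead_ne_zero (hH0 m)
  have hgal : ∀ (σ : Kbar K ≃ₐ[K] Kbar K) m, ∃ (m' : Fin 6) (t : Kbar K),
      (fun j => σ (H m j)) = t • H m' := by
    intro σ m
    have hx : ∀ x, ∃ y, ∃ t : Kbar K, t • P y = fun j => σ (P x j) := by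
      intro x
      refine hall _ (fun h0 => (hP x).ne_zero ?_) ((hPs x).conj σ)
      ext j
      simpa using congrFun h0 j
    choose τ t ht using hx
    have ht0 : ∀ x, t x ≠ 0 := by
      intro x h0
      refine (hP x).ne_zero ?_
      ext j
      have := congrFun (ht x) j
      simpa [h0] using this.symm
    have hτ : Function.Injective τ := by
      intro x y hxy
      refine hprop x y (σ.symm (t x / t y)) ?_
      ext j
      apply σ.injective
      have h1 := congrFun (ht x) j
      have h2 := congrFun (ht y) j
      simp only [Pi.smul_apply, smul_eq_mul] at h1 h2 ⊢
      rw [map_mul, σ.apply_symm_apply, ← h1, ← h2, hxy]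
      field_simp [ht0 y]
    -- The conjugate hyperplane contains the conjugates of the six nodes on `H m`, and these are
    -- again six nodes.
    refine exists_eq_smul_of_six_le hsum hker' hP ?_
    rw [← card_nodes_on hP m]
    refine Finset.card_le_card_of_injOn τ ?_ hτ.injOn
    intro x hx
    simp only [Finset.coe_filter, Finset.mem_univ, true_and] at hx ⊢
    have h1 : t x * ((fun j => σ (H m j)) ⬝ᵥ P (τ x)) = 0 := by
      rw [← smul_eq_mul, ← dotProduct_smul, ht]
      simp only [dotProduct, ← map_mul, ← map_sum]
      rw [show ∑ j, H m j * P x j = 0 from hx, map_zero]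
    exact (mul_eq_zero.1 h1).resolve_left (ht0 x)
  -- Conjugation permutes the `H m` only up to scalars; with leading coefficient 1 the scalars
  -- disappear.
  let N : Fin 6 → Fin 5 → Kbar K := fun m => (lead (H m))⁻¹ • H m
  have hN : ∀ m, H m = lead (H m) • N m := fun m => by
    simp [N, smul_smul, hlead m]
  have hNv : ∀ m v, H m ⬝ᵥ v = lead (H m) * N m ⬝ᵥ v := fun m v => by
    conv_lhs => rw [hN m, smul_dotProduct, smul_eq_mul]
  have hinj : Function.Injective N := by
    intro m m' hmm
    refine hprop' m m' (lead (H m) * (lead (H m'))⁻¹) ?_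
    rw [mul_smul]
    change _ = lead (H m) • N m'
    rw [← hmm, ← hN]
  refine ⟨N, fun m => lead (H m), a * (lead (H 0) * lead (H 1) * lead (H 2)),
    b * (lead (H 3) * lead (H 4) * lead (H 5)), ?_, ?_, hlead, ?_, ?_, hinj, ?_, ?_⟩
  · simp [ha, hlead]
  · simp [hb, hlead]
  · simp only [← hN, hsum]
  · exact fun v hv => hker' v fun i => by rw [hNv, hv, mul_zero]
  · intro v
    simp only [hF, hNv]
    ring
  · intro σ
    choose π t ht using hgal σ
    have ht0 : ∀ m, t m ≠ 0 := by
      intro m h0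
      refine hH0 m ?_
      ext j
      have := congrFun (ht m) j
      simpa [h0] using this
    have hπN : ∀ m, (fun j => σ (N m j)) = N (π m) := by
      intro m
      have h1 := lead_map (σ : Kbar K →+* Kbar K) (H m)
      change lead (fun j => σ (H m j)) = σ (lead (H m)) at h1
      rw [ht, lead_smul (ht0 m)] at h1
      ext j
      have h2 := congrFun (ht m) j
      simp only [N, Pi.smul_apply, smul_eq_mul, map_mul, map_inv₀, ← h1] at h2 ⊢
      rw [h2]
      have := ht0 m
      have := hlead (π m)
      field_simp
    have hπ : Function.Injective π := by
      intro m m' hmm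
      apply hinj
      ext j
      apply σ.injective
      have h1 := congrFun (hπN m) j
      have h2 := congrFun (hπN m') j
      rw [h1, h2, hmm]
    exact ⟨Equiv.ofBijective π (Finite.injective_iff_bijective.1 hπ), hπN⟩

end Galois

/-! ### Rigidity of the two blocks, separation of points by monomials, and pull-backs. -/

section Descent

open MvPolynomial Matrix

/-- One of the two blocks of coordinates of the Perazzo cubic. -/
abbrev leftBlock : Finset (Fin 6) := {0, 1, 2}

section Blocks

variable {k : Type*} [Field k] {r : Fin 6 → k} {T : Finset (Fin 6)} {s : Fin 6}

open Classical in
/-- A point of the hyperplane `∑ rᵢ zᵢ = 0` with support in `T ∪ {s}`. -/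
def testPoint (r : Fin 6 → k) (T : Finset (Fin 6)) (s i : Fin 6) : k :=
  if i ∈ T then (r i)⁻¹ else if i = s then -3 * (r i)⁻¹ else 0

/-- The entry at `s` cancels the three equal contributions from `T`. In characteristic 3 it is zero,
which is harmless, as only the product over `T` has to be nonzero. -/
theorem sum_testPoint (hr : ∀ i, r i ≠ 0) (hT : T.card = 3) (hs : s ∉ T) :
    ∑ i, r i * testPoint r T s i = 0 := by
  classical
  have : ∀ i, r i * testPoint r T s i = (if i ∈ T then 1 else 0) + if i = s then -3 else 0 := by
    intro i
    have := hr i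
    unfold testPoint
    split_ifs with h1 h2 h3
    · exact absurd (h2 ▸ h1) hs
    · field_simp; simp
    · field_simp; simp
    · simp
  simp only [this, Finset.sum_add_distrib, Finset.sum_ite_mem, Finset.univ_inter,
    Finset.sum_const, hT, Finset.sum_ite_eq', Finset.mem_univ, if_true]
  norm_num

theorem prod_testPoint_ne_zero (hr : ∀ i, r i ≠ 0) : ∏ i ∈ T, testPoint r T s i ≠ 0 :=
  Finset.prod_ne_zero_iff.2 fun i hi => by simp [testPoint, hi, hr]

theorem prod_testPoint_eq_zero {U : Finset (Fin 6)} {p : Fin 6} (hp : p ∈ U) (hpT : p ∉ T)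
    (hps : p ≠ s) : ∏ i ∈ U, testPoint r T s i = 0 :=
  Finset.prod_eq_zero hp (by simp [testPoint, hpT, hps])

/-- If `T` is neither block, the test point of `T` and `s` annihilates the products over both blocks
and over the complement of `T`, but not the product over `T`. -/
theorem exists_separating_of_ne : ∀ T : Finset (Fin 6), T.card = 3 → T ≠ leftBlock →
    T ≠ leftBlockᶜ → ∃ p q s, p ∈ leftBlock ∧ p ∉ T ∧ q ∈ leftBlockᶜ ∧ q ∉ T ∧ s ∉ T ∧ p ≠ s ∧
      q ≠ s := by
  decide +kernel

/-- The restriction of the Perazzo cubic to a hyperplane in general position determines the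
partition of the coordinates into two blocks and the coefficients. -/
theorem block_unique (hr : ∀ i, r i ≠ 0) {a b a' b' : k} (ha' : a' ≠ 0) (hT : T.card = 3)
    (h : ∀ z : Fin 6 → k, ∑ i, r i * z i = 0 →
      a * ∏ i ∈ leftBlock, z i + b * ∏ i ∈ leftBlockᶜ, z i =
        a' * ∏ i ∈ T, z i + b' * ∏ i ∈ Tᶜ, z i) :
    (T = leftBlock ∧ a' = a ∧ b' = b) ∨ (T = leftBlockᶜ ∧ a' = b ∧ b' = a) := by
  have hL := h _ (sum_testPoint (T := leftBlock) (s := 3) hr (by decide) (by decide))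
  rw [prod_testPoint_eq_zero (U := leftBlockᶜ) (p := 4) (by decide) (by decide) (by decide)] at hL
  have hR := h _ (sum_testPoint (T := leftBlockᶜ) (s := 0) hr (by decide) (by decide))
  rw [prod_testPoint_eq_zero (U := leftBlock) (p := 1) (by decide) (by decide) (by decide)] at hR
  by_cases h1 : T = leftBlock
  · subst h1
    rw [prod_testPoint_eq_zero (U := leftBlockᶜ) (p := 4) (by decide) (by decide) (by decide)] at hL
    rw [prod_testPoint_eq_zero (U := leftBlock) (p := 1) (by decide) (by decide) (by decide)] at hR
    exact Or.inl ⟨rfl,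
      mul_right_cancel₀ (prod_testPoint_ne_zero (T := leftBlock) (s := 3) hr)
        (by linear_combination -hL),
      mul_right_cancel₀ (prod_testPoint_ne_zero (T := leftBlockᶜ) (s := 0) hr)
        (by linear_combination -hR)⟩
  by_cases h2 : T = leftBlockᶜ
  · subst h2
    rw [compl_compl] at hL hR
    rw [prod_testPoint_eq_zero (U := leftBlockᶜ) (p := 4) (by decide) (by decide) (by decide)] at hL
    rw [prod_testPoint_eq_zero (U := leftBlock) (p := 1) (by decide) (by decide) (by decide)] at hR
    exact Or.inr ⟨rfl,
      mul_right_cancel₀ (prod_testPoint_ne_zero (T := leftBlockᶜ) (s := 0) hr)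
        (by linear_combination -hR),
      mul_right_cancel₀ (prod_testPoint_ne_zero (T := leftBlock) (s := 3) hr)
        (by linear_combination -hL)⟩
  · obtain ⟨p, q, s, hp, hpT, hq, hqT, hs, hps, hqs⟩ := exists_separating_of_ne T hT h1 h2
    have := h _ (sum_testPoint hr hT hs)
    rw [prod_testPoint_eq_zero hp hpT hps, prod_testPoint_eq_zero hq hqT hqs,
      prod_testPoint_eq_zero (Finset.mem_compl.2 hpT) hpT hps] at this
    have h0 : a' * ∏ i ∈ T, testPoint r T s i = 0 := by linear_combination -this
    exact absurd h0 (mul_ne_zero ha' (prod_testPoint_ne_zero hr))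

end Blocks

/-- Finitely many points are separated by monomials. -/
theorem exists_monomial_matrix {k ι : Type*} [Field k] [Nonempty ι] {n : ℕ} {N : Fin n → ι → k}
    (hN : Function.Injective N) :
    ∃ e : Fin n → ι →₀ ℕ, IsUnit (Matrix.of fun i l => eval (N i) (monomial (e l) (1 : k))) := by
  classical
  let φ : (ι →₀ ℕ) → Fin n → k := fun d i => eval (N i) (monomial d (1 : k))
  have hpoly : ∀ p : MvPolynomial ι k,
      (fun i => eval (N i) p) ∈ Submodule.span k (Set.range φ) := by
    intro p
    induction p using MvPolynomial.induction_on' with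
    | monomial d a =>
      have : (fun i => eval (N i) (monomial d a)) = a • φ d := by
        ext i; simp [φ, eval_monomial]
      rw [this]
      exact Submodule.smul_mem _ _ (Submodule.subset_span ⟨d, rfl⟩)
    | add p q hp hq =>
      simp only [map_add]
      exact Submodule.add_mem _ hp hq
  have hspan : Submodule.span k (Set.range φ) = ⊤ := by
    rw [eq_top_iff]
    intro v _
    have hj : ∀ i i', i ≠ i' → ∃ j, N i j ≠ N i' j := fun i i' h => by
      by_contra! hc
      exact h (hN (funext hc))
    choose! j hj using hj
    -- Interpolation: `q i` vanishes at every point except the `i`-th, so the values of polynomials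
    -- fill the whole space.
    let q : Fin n → MvPolynomial ι k := fun i =>
      ∏ i' ∈ Finset.univ.erase i, (X (j i i') - C (N i' (j i i')))
    have hq : ∀ i, eval (N i) (q i) ≠ 0 := by
      intro i
      simp only [q, eval_prod, map_sub, eval_X, eval_C]
      exact Finset.prod_ne_zero_iff.2 fun i' hi' =>
        sub_ne_zero.2 (hj i i' (Finset.ne_of_mem_erase hi').symm)
    have hq' : ∀ i i', i' ≠ i → eval (N i') (q i) = 0 := by
      intro i i' hi
      simp only [q, eval_prod, map_sub, eval_X, eval_C]
      exact Finset.prod_eq_zero (Finset.mem_erase.2 ⟨hi, Finset.mem_univ i'⟩) (sub_self _)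
    convert hpoly (∑ i, C (v i * (eval (N i) (q i))⁻¹) * q i) using 1
    ext i
    rw [eval_sum, Finset.sum_eq_single i]
    · simp [hq i]
    · intro i' _ hi'
      simp [hq' i' i hi'.symm]
    · simp
  obtain ⟨B, hB, hBs, hli⟩ := exists_linearIndependent k (Set.range φ)
  rw [hspan] at hBs
  have hfin : Finite B := hli.finite
  have := Fintype.ofFinite B
  have hcard : Fintype.card B = n := by
    have := finrank_span_eq_card hli
    rw [Subtype.range_coe, hBs, finrank_top] at this
    simpa using this.symm
  let E := (Fintype.equivFinOfCardEq hcard).symm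
  choose e he using fun l => hB (E l).2
  refine ⟨e, ?_⟩
  rw [← Matrix.linearIndependent_cols_iff_isUnit]
  have hcol : (Matrix.of fun i l => eval (N i) (monomial (e l) (1 : k))).col =
      Subtype.val ∘ E := by
    ext l i
    exact congrFun (he l) i
  rw [hcol]
  exact hli.comp E E.injective

section Pullback

variable {k : Type*} [Field k] {ι κ l : Type*} [Fintype κ] [Fintype l]

theorem pullback_pullback (A : Matrix ι κ k) (B : Matrix κ l k) (F : MvPolynomial ι k) :
    pullback B (pullback A F) = pullback (A * B) F := by
  unfold pullback
  rw [bind₁_bind₁]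
  congr 2
  ext1 i
  simp only [map_sum, map_mul, bind₁_C_right, bind₁_X_right, Matrix.mul_apply, Finset.sum_mul,
    Finset.mul_sum, mul_assoc]
  rw [Finset.sum_comm]

theorem eval_pullback (A : Matrix ι κ k) (F : MvPolynomial ι k) (v : κ → k) :
    eval v (pullback A F) = eval (A *ᵥ v) F := by
  induction F using MvPolynomial.induction_on with
  | C a => simp [pullback]
  | add p q hp hq => simpa [pullback] using congrArg₂ (· + ·) hp hq
  | mul_X p i hp =>
    rw [map_mul, ← hp]
    simp [pullback, Matrix.mulVec, dotProduct]

theorem map_pullback {k' : Type*} [Field k'] (σ : k →+* k') (A : Matrix ι κ k)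
    (F : MvPolynomial ι k) : map σ (pullback A F) = pullback (A.map σ) (map σ F) := by
  unfold pullback
  rw [map_bind₁]
  congr 2
  ext1 i
  simp

theorem isHomogeneous_pullback (A : Matrix ι κ k) {F : MvPolynomial ι k} {n : ℕ}
    (hF : F.IsHomogeneous n) : (pullback A F).IsHomogeneous n := by
  have := hF.aeval (fun i => ∑ j, C (A i j) * X j) (n := 1) fun i =>
    IsHomogeneous.sum _ _ _ fun j _ => by
      simpa using (isHomogeneous_C κ (A i j)).mul (isHomogeneous_X k j)
  rwa [one_mul] at this

end Pullback

end Descent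

/-! ### Descent of the fourfold and of the hyperplane to the ground field. -/

section Descent

open MvPolynomial Matrix

theorem prod_leftBlock {M : Type*} [CommMonoid M] (g : Fin 6 → M) :
    ∏ i ∈ leftBlock, g i = g 0 * g 1 * g 2 := by
  simp [leftBlock, mul_assoc]

theorem prod_leftBlock_compl {M : Type*} [CommMonoid M] (g : Fin 6 → M) :
    ∏ i ∈ leftBlockᶜ, g i = g 3 * g 4 * g 5 := by
  rw [show leftBlockᶜ = ({3, 4, 5} : Finset (Fin 6)) by decide]
  simp [mul_assoc]

/-- The diagonal form `a z₀ z₁ z₂ + b z₃ z₄ z₅` of the Perazzo cubic. -/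
def blockForm {k : Type*} [Field k] (a b : k) : MvPolynomial (Fin 6) k :=
  C a * ∏ i ∈ leftBlock, X i + C b * ∏ i ∈ leftBlockᶜ, X i

theorem blockForm_isHomogeneous {k : Type*} [Field k] (a b : k) :
    (blockForm a b).IsHomogeneous 3 := by
  refine IsHomogeneous.add ?_ ?_
  · simpa using ((IsHomogeneous.prod leftBlock (fun i => X (R := k) i) (fun _ => 1)
      fun i _ => isHomogeneous_X k i).C_mul a)
  · have := ((IsHomogeneous.prod leftBlockᶜ (fun i => X (R := k) i) (fun _ => 1)
      fun i _ => isHomogeneous_X k i).C_mul b)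
    rwa [show ∑ i ∈ leftBlockᶜ, 1 = 3 by decide] at this

theorem pullback_blockForm {k κ : Type*} [Field k] [Fintype κ] (a b : k)
    (A : Matrix (Fin 6) κ k) : pullback A (blockForm a b) =
      C a * ∏ i ∈ leftBlock, (∑ j, C (A i j) * X j) +
        C b * ∏ i ∈ leftBlockᶜ, (∑ j, C (A i j) * X j) := by
  simp only [pullback, blockForm, map_add, map_mul, map_prod, bind₁_C_right, bind₁_X_right]

theorem eval_pullback_blockForm {k κ : Type*} [Field k] [Fintype κ] (a b : k)
    (A : Matrix (Fin 6) κ k) (v : κ → k) : eval v (pullback A (blockForm a b)) =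
      a * ∏ i ∈ leftBlock, (A *ᵥ v) i + b * ∏ i ∈ leftBlockᶜ, (A *ᵥ v) i := by
  simp only [eval_pullback, blockForm, map_add, map_mul, eval_prod, eval_C, eval_X]

/-- The Perazzo cubic in diagonal form is equivalent to the split one. -/
theorem exists_pullback_blockForm {k : Type*} [Field k] {a b : k} (ha : a ≠ 0) (hb : b ≠ 0) :
    ∃ D : Matrix (Fin 6) (Fin 6) k, IsUnit D ∧ pullback D (blockForm a b) = perazzoForm k := by
  refine ⟨Matrix.diagonal ![a⁻¹, 1, 1, -b⁻¹, 1, 1], ?_, ?_⟩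
  · rw [Matrix.isUnit_iff_isUnit_det, Matrix.det_diagonal, isUnit_iff_ne_zero]
    simp [Fin.prod_univ_six, ha, hb]
  · have hdiag : ∀ (d : Fin 6 → k) i, ∑ j, C (Matrix.diagonal d i j) * X j =
        (C (d i) * X i : MvPolynomial (Fin 6) k) := by
      intro d i
      rw [Finset.sum_eq_single i]
      · simp
      · intro j _ hj
        rw [Matrix.diagonal_apply_ne _ hj.symm]; simp
      · simp
    rw [pullback_blockForm]
    simp only [hdiag]
    rw [prod_leftBlock, prod_leftBlock_compl, perazzoForm]
    simp only [Matrix.cons_val, map_one, one_mul, map_neg]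
    have h1 : C a * C a⁻¹ = (1 : MvPolynomial (Fin 6) k) := by
      rw [← C_mul, mul_inv_cancel₀ ha, C_1]
    have h2 : C b * C b⁻¹ = (1 : MvPolynomial (Fin 6) k) := by
      rw [← C_mul, mul_inv_cancel₀ hb, C_1]
    linear_combination X 0 * X 1 * X 2 * h1 - X 3 * X 4 * X 5 * h2

theorem geom_pullback {K ι κ : Type*} [Field K] [Fintype κ] (A : Matrix ι κ K)
    (F : MvPolynomial ι K) :
    geom (pullback A F) = pullback (A.map (algebraMap K (Kbar K))) (geom F) :=
  map_pullback _ _ _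

theorem geom_injective {K : Type*} [Field K] (ι : Type*) :
    Function.Injective (geom : MvPolynomial ι K → MvPolynomial ι (Kbar K)) :=
  map_injective _ (algebraMap K (Kbar K)).injective

theorem map_geom {K ι : Type*} [Field K] (σ : Kbar K ≃ₐ[K] Kbar K) (F : MvPolynomial ι K) :
    map (σ : Kbar K →+* Kbar K) (geom F) = geom F := by
  rw [geom, MvPolynomial.map_map]
  congr 1
  ext x
  · simp
  · simp

theorem isPerazzoCubicFourfold_of_pullback {K : Type*} [Field K] {F : MvPolynomial (Fin 6) K}
    {M : Matrix (Fin 6) (Fin 6) (Kbar K)} (hM : IsUnit M) {a b : Kbar K} (ha : a ≠ 0) (hb : b ≠ 0)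
    (hF : geom F = pullback M (blockForm a b)) : IsPerazzoCubicFourfold F := by
  obtain ⟨D, hD, hDF⟩ := exists_pullback_blockForm ha hb
  obtain ⟨g, hg⟩ : IsUnit (M⁻¹ * D) := (Matrix.isUnit_nonsing_inv_iff.2 hM).mul hD
  have hpull : pullback (g : Matrix (Fin 6) (Fin 6) (Kbar K)) (geom F) = perazzoForm (Kbar K) := by
    rw [hg, hF, pullback_pullback, ← mul_assoc,
      Matrix.mul_nonsing_inv _ ((Matrix.isUnit_iff_isUnit_det _).1 hM), one_mul, hDF]
  refine ⟨⟨?_, ?_⟩, g, 1, by rw [hpull]; simp⟩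
  · refine IsHomogeneous.of_map (algebraMap K (Kbar K)).injective ?_
    change (geom F).IsHomogeneous 3
    rw [hF]
    exact isHomogeneous_pullback _ (blockForm_isHomogeneous a b)
  · rintro rfl
    have := congrArg (eval ![1, 1, 1, 0, 0, 0]) hpull
    simp [geom, pullback, perazzoForm] at this

/-- A matrix of full rank identifies its source with a hyperplane. -/
theorem exists_hyperplane_eq_range {K : Type*} [Field K] {A : Matrix (Fin 6) (Fin 5) K}
    (hA : Function.Injective A.mulVec) :
    ∃ ℓ : Fin 6 → K, ℓ ≠ 0 ∧ Set.range A.mulVec = {z | ∑ i, ℓ i * z i = 0} := by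
  have hr : Module.finrank K (LinearMap.range A.mulVecLin) = 5 := by
    rw [LinearMap.finrank_range_of_inj hA]; simp
  have hlt : LinearMap.range A.mulVecLin < ⊤ := by
    rw [lt_top_iff_ne_top]
    intro h
    rw [h, finrank_top] at hr
    simp at hr
  obtain ⟨φ, hφ, hle⟩ := Submodule.exists_le_ker_of_lt_top _ hlt
  have hφz : ∀ z, φ z = ∑ i, φ (Pi.single i 1) * z i := by
    intro z
    conv_lhs => rw [← Finset.univ_sum_single z, map_sum]
    refine Finset.sum_congr rfl fun i _ => ?_
    have h1 : Pi.single i (z i) = z i • (Pi.single i 1 : Fin 6 → K) := by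
      rw [← Pi.single_smul, smul_eq_mul, mul_one]
    rw [h1, map_smul, smul_eq_mul, mul_comm]
  have hker : Module.finrank K (LinearMap.ker φ) = 5 := by
    have h1 := φ.finrank_range_add_finrank_ker
    rw [LinearMap.range_eq_top.2 (LinearMap.surjective hφ)] at h1
    simp at h1
    omega
  have heq := Submodule.eq_of_le_of_finrank_eq hle (hr.trans hker.symm)
  refine ⟨fun i => φ (Pi.single i 1), fun h => hφ ?_, ?_⟩
  · refine LinearMap.ext fun z => ?_
    rw [hφz]
    exact Finset.sum_eq_zero fun i _ => by rw [congrFun h i]; exact zero_mul _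
  · ext z
    have : z ∈ LinearMap.range A.mulVecLin ↔ z ∈ LinearMap.ker φ := by rw [heq]
    rw [LinearMap.mem_ker, hφz] at this
    exact this

/-- A nine-nodal cubic threefold over a perfect field is a hyperplane section of a Perazzo cubic
fourfold. -/
theorem IsNineNodalCubicThreefold.exists_isHyperplaneSection {K : Type*} [Field K] [PerfectField K]
    {f : MvPolynomial (Fin 5) K} (hf : IsNineNodalCubicThreefold f) :
    ∃ F : MvPolynomial (Fin 6) K, IsPerazzoCubicFourfold F ∧ IsHyperplaneSection f F := by
  classical
  obtain ⟨N, r, a, b, ha, hb, hr, hsum, hker, hinj, hF, hgal⟩ := hf.exists_galois_forms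
  obtain ⟨e, he⟩ := exists_monomial_matrix hinj
  -- Perfectness enters here: the algebraic closure is a Galois extension, so the fixed elements lie
  -- in `K`.
  have hfix : ∀ x : Kbar K, (∀ σ : Kbar K ≃ₐ[K] Kbar K, σ x = x) →
      x ∈ Set.range (algebraMap K (Kbar K)) := fun x hx =>
    (InfiniteGalois.mem_range_algebraMap_iff_fixed x).2 hx
  set M : Matrix (Fin 6) (Fin 6) (Kbar K) :=
    Matrix.of fun i l => eval (N i) (monomial (e l) (1 : Kbar K)) with hM
  have hMσ : ∀ (σ : Kbar K ≃ₐ[K] Kbar K) (π : Fin 6 ≃ Fin 6),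
      (∀ m, (fun j => σ (N m j)) = N (π m)) → ∀ i l, σ (M i l) = M (π i) l := by
    intro σ π hπ i l
    simp only [hM, Matrix.of_apply, ← hπ, eval_monomial, one_mul, Finsupp.prod, map_prod, map_pow]
  have hMM : M * M⁻¹ = 1 := Matrix.mul_nonsing_inv _ ((Matrix.isUnit_iff_isUnit_det _).1 he)
  have hN : geom f = pullback (Matrix.of N) (blockForm a b) := by
    refine MvPolynomial.funext fun v => ?_
    rw [hF, eval_pullback_blockForm, prod_leftBlock, prod_leftBlock_compl]
    rfl
  -- An automorphism permutes the rows of `M` and of `N` in the same way, so the solution of `M * A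
  -- = N` is fixed.
  have hA : ∀ i j, (M⁻¹ * Matrix.of N) i j ∈ Set.range (algebraMap K (Kbar K)) := by
    intro i j
    refine hfix _ fun σ => ?_
    obtain ⟨π, hπ⟩ := hgal σ
    have h1 : M * (M⁻¹ * Matrix.of N) = Matrix.of N := by rw [← Matrix.mul_assoc, hMM, Matrix.one_mul]
    have h2 : M * (M⁻¹ * Matrix.of N).map σ = Matrix.of N := by
      ext i' j'
      obtain ⟨i, rfl⟩ := π.surjective i'
      have h3 := congrArg σ (congrFun (congrFun h1 i) j')
      rw [Matrix.mul_apply, map_sum] at h3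
      simp only [map_mul, hMσ σ π hπ] at h3
      rw [Matrix.mul_apply]
      exact h3.trans (congrFun (hπ i) j')
    have h4 : (M⁻¹ * Matrix.of N).map σ = M⁻¹ * Matrix.of N := by
      conv_rhs => rw [← h2]
      rw [← Matrix.mul_assoc, Matrix.nonsing_inv_mul _ ((Matrix.isUnit_iff_isUnit_det _).1 he),
        Matrix.one_mul]
    exact congrFun (congrFun h4 i) j
  choose A hA using hA
  have hAmap : (Matrix.of A).map (algebraMap K (Kbar K)) = M⁻¹ * Matrix.of N := by
    ext i j; exact hA i j
  have hG : ∀ σ : Kbar K ≃ₐ[K] Kbar K, map (σ : Kbar K →+* Kbar K)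
      (pullback M (blockForm a b)) = pullback M (blockForm a b) := by
    intro σ
    obtain ⟨π, hπ⟩ := hgal σ
    have hprod : ∀ {R : Type _} [CommRing R] (S : Finset (Fin 6)) (g : Fin 6 → R),
        ∏ i ∈ S, g (π i) = ∏ i ∈ S.map π.toEmbedding, g i := fun S g => by
      rw [Finset.prod_map]; rfl
    have hcompl : leftBlockᶜ.map π.toEmbedding = (leftBlock.map π.toEmbedding)ᶜ := by
      ext i
      simp only [Finset.mem_map_equiv, Finset.mem_compl]
    -- On the hyperplane the form restricts to `f`, which is invariant; `block_unique` then extends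
    -- the invariance to the whole 6-space.
    have hid : ∀ z : Fin 6 → Kbar K, ∑ i, r i * z i = 0 →
        a * ∏ i ∈ leftBlock, z i + b * ∏ i ∈ leftBlockᶜ, z i =
          σ a * ∏ i ∈ leftBlock.map π.toEmbedding, z i +
            σ b * ∏ i ∈ (leftBlock.map π.toEmbedding)ᶜ, z i := by
      intro z hz
      obtain ⟨v, hv⟩ := exists_dotProduct_eq (H := fun i => r i • N i) hsum
        (fun v hv => hker v fun i => by simpa [smul_dotProduct, hr i] using hv i)
        (γ := fun i => r i * z i) hz
      have hv' : ∀ i, (Matrix.of N *ᵥ v) i = z i := by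
        intro i
        have := hv i
        rw [smul_dotProduct, smul_eq_mul] at this
        exact mul_left_cancel₀ (hr i) this
      have h1 := map_geom σ f
      rw [hN, map_pullback] at h1
      have h2 := congrArg (eval v) h1
      have h3 : map (σ : Kbar K →+* Kbar K) (blockForm a b) = blockForm (σ a) (σ b) := by
        simp [blockForm]
      have h4 : ∀ i, ((Matrix.of N).map (σ : Kbar K →+* Kbar K) *ᵥ v) i = z (π i) := by
        intro i
        rw [← hv']
        change (fun j => σ (N i j)) ⬝ᵥ v = _
        rw [hπ]
        rfl
      rw [h3, eval_pullback_blockForm, eval_pullback_blockForm] at h2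
      simp only [hv', h4] at h2
      rw [hprod, hprod, hcompl] at h2
      exact h2.symm
    have hT : (leftBlock.map π.toEmbedding).card = 3 := by rw [Finset.card_map]; rfl
    have hmap : map (σ : Kbar K →+* Kbar K) (pullback M (blockForm a b)) =
        C (σ a) * ∏ i ∈ leftBlock.map π.toEmbedding, (∑ j, C (M i j) * X j) +
          C (σ b) * ∏ i ∈ (leftBlock.map π.toEmbedding)ᶜ, (∑ j, C (M i j) * X j) := by
      rw [← hcompl, ← hprod leftBlock fun i => ∑ j, C (M i j) * X j,
        ← hprod leftBlockᶜ fun i => ∑ j, C (M i j) * X j, pullback_blockForm]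
      simp only [map_add, map_mul, map_prod, map_sum, map_C, map_X, RingHom.coe_coe, hMσ σ π hπ]
    rw [hmap, pullback_blockForm]
    rcases block_unique hr (by simpa using ha) hT hid with ⟨h1, h2, h3⟩ | ⟨h1, h2, h3⟩
    · rw [h1, h2, h3]
    · rw [h1, h2, h3, compl_compl, add_comm]
  -- All coefficients of the invariant form are fixed by the Galois group, so it comes from `K`.
  obtain ⟨F, hF'⟩ : ∃ F : MvPolynomial (Fin 6) K, geom F = pullback M (blockForm a b) := by
    refine mem_range_map_iff_coeffs_subset.2 fun x hx => hfix x fun σ => ?_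
    obtain ⟨d, -, rfl⟩ := mem_coeffs_iff.1 hx
    conv_rhs => rw [← hG σ, coeff_map]
    rfl
  have hpull : pullback (Matrix.of A) F = f := by
    apply geom_injective
    rw [geom_pullback, hAmap, hF', pullback_pullback, ← Matrix.mul_assoc, hMM, Matrix.one_mul, hN]
  have hinjA : Function.Injective (Matrix.of A).mulVec := by
    rw [← Matrix.coe_mulVecLin, ← LinearMap.ker_eq_bot, LinearMap.ker_eq_bot']
    intro x hx
    have hx' : (Matrix.of A) *ᵥ x = 0 := hx
    have h1 : Matrix.of N *ᵥ (fun j => algebraMap K (Kbar K) (x j)) = 0 := by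
      have h2 : Matrix.of N = M * (Matrix.of A).map (algebraMap K (Kbar K)) := by
        rw [hAmap, ← Matrix.mul_assoc, hMM, Matrix.one_mul]
      rw [h2, ← Matrix.mulVec_mulVec]
      have h3 : (Matrix.of A).map (algebraMap K (Kbar K)) *ᵥ
          (fun j => algebraMap K (Kbar K) (x j)) = 0 := by
        ext i
        have := congrArg (algebraMap K (Kbar K)) (congrFun hx' i)
        simpa [Matrix.mulVec, dotProduct] using this
      rw [h3, Matrix.mulVec_zero]
    have h0 := hker _ fun i => congrFun h1 i
    ext j
    simpa using congrFun h0 j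
  obtain ⟨ℓ, hℓ, hrange⟩ := exists_hyperplane_eq_range hinjA
  exact ⟨F, isPerazzoCubicFourfold_of_pullback he ha hb hF', ℓ, hℓ, Matrix.of A, hinjA, hrange, 1,
    by rw [hpull]; simp⟩

end Descent

end NineNodal

end

theorem proposition2p2 {K : Type*} [Field K] [PerfectField K]
    (f : MvPolynomial (Fin 5) K) (hf : NineNodal.IsNineNodalCubicThreefold f) :
    ∃ F : MvPolynomial (Fin 6) K,
      NineNodal.IsPerazzoCubicFourfold F ∧ NineNodal.IsHyperplaneSection f F :=
  hf.exists_isHyperplaneSection
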